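/- Let $0<p<1$ be a constant, and let $G\in\mathcal G_{n,p}$ be a random graph on $n$ labelled vertices $1,\dots,n$ in which every pair of distinct vertices is joined by an edge independently with probability $p$. Let $d_i$ be the degree of the vertex $i$ in $G$ and $D(i,j)$ the distance between $i$ and $j$ in $G$. The additively weighted Harary matrix $H_A(G)$ and the multiplicatively weighted Harary matrix $H_M(G)$ are the real symmetric $n\times n$ matrices with zero diagonal and with off-diagonal entries $$H_A(G)(i,j)=\frac{d_i+d_j}{D(i,j)},\qquad H_M(G)(i,j)=\frac{d_i d_j}{D(i,j)}\qquad (i\neq j),$$ where an entry is $0$ if $i$ and $j$ lie in different components of $G$. The energy $\mathscr E(X)$ of a real symmetric matrix $X$ is the sum of the absolute values of its eigenvalues, counted with multiplicity. Then, as $n\to\infty$, $$\mathscr E(H_A(G))=\Bigl(\frac{8}{3\pi}\,p\sqrt{p(1-p)}+o(1)\Bigr)n^{5/2}\quad\text{a.s.}$$ and $$\mathscr E(H_M(G))=\Bigl(\frac{4}{3\pi}\,p^2\sqrt{p(1-p)}+o(1)\Bigr)n^{7/2}\quad\text{a.s.}$$ Here "a.s." means "with probability tending to $1$ as $n$ tends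 to infinity": a statement $\mathscr E=(c+o(1))n^a$ a.s. says that for every $\varepsilon>0$ the probability that $|\mathscr E-c\,n^a|\le\varepsilon n^a$ tends to $1$ as $n\to\infty$. -/

import Mathlib

open Filter Topology

/-- The weighted distance matrix `W_f(G)` of a graph `G`: the `ij`-entry is `f(D(i,j), d_i, d_j)` for
`i ≠ j` and `0` for `i = j`, where `D(i,j)` is the distance and `d_i` is the degree in `G`. -/
noncomputable def weightedDistanceMatrix {V : Type*} [Fintype V] (f : ℕ → ℕ → ℕ → ℝ)
    (G : SimpleGraph V) : Matrix V V ℝ :=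
  open Classical in
  Matrix.of fun i j => if i = j then 0 else f (G.dist i j) (G.degree i) (G.degree j)

theorem weightedDistanceMatrix_isHermitian {V : Type*} [Fintype V] {f : ℕ → ℕ → ℕ → ℝ}
    (hf : ∀ D a b, f D a b = f D b a) (G : SimpleGraph V) :
    (weightedDistanceMatrix f G).IsHermitian := by
  classical
  ext i j
  simp only [weightedDistanceMatrix, Matrix.conjTranspose_apply, Matrix.of_apply, star_trivial]
  rw [G.dist_comm, hf]
  simp only [eq_comm]

/-- The energy of a real symmetric matrix: the sum of the absolute values of its eigenvalues,
counted with multiplicity. -/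
noncomputable def matrixEnergy {V : Type*} [Fintype V] [DecidableEq V] (A : Matrix V V ℝ)
    (hA : A.IsHermitian) : ℝ :=
  ∑ i, |hA.eigenvalues i|

/-- The weight function of the additively weighted Harary matrix. Two vertices in different
components have `SimpleGraph.dist` equal to `0`, so their entry is `0`, that is, `1 / ∞ = 0`. -/
noncomputable def additiveHararyWeight (D a b : ℕ) : ℝ := ((a : ℝ) + (b : ℝ)) / (D : ℝ)

/-- The weight function of the multiplicatively weighted Harary matrix, with the same convention
for two vertices in different components. -/
noncomputable def multiplicativeHararyWeight (D a b : ℕ) : ℝ := ((a : ℝ) * (b : ℝ)) / (D : ℝ)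

/-- The additively weighted Harary matrix `H_A(G)`. -/
noncomputable def additiveHararyMatrix {V : Type*} [Fintype V] (G : SimpleGraph V) :
    Matrix V V ℝ :=
  weightedDistanceMatrix additiveHararyWeight G

/-- The multiplicatively weighted Harary matrix `H_M(G)`. -/
noncomputable def multiplicativeHararyMatrix {V : Type*} [Fintype V] (G : SimpleGraph V) :
    Matrix V V ℝ :=
  weightedDistanceMatrix multiplicativeHararyWeight G

theorem additiveHararyMatrix_isHermitian {V : Type*} [Fintype V] (G : SimpleGraph V) :
    (additiveHararyMatrix G).IsHermitian :=
  weightedDistanceMatrix_isHermitian (fun D a b => by simp [additiveHararyWeight, add_comm]) G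

theorem multiplicativeHararyMatrix_isHermitian {V : Type*} [Fintype V] (G : SimpleGraph V) :
    (multiplicativeHararyMatrix G).IsHermitian :=
  weightedDistanceMatrix_isHermitian (fun D a b => by simp [multiplicativeHararyWeight, mul_comm]) G

/-- With probability tending to `1` as `n → ∞`, the random graph `G(n, p)` has the property `P n`. -/
def WithHighProbability (p : unitInterval) (P : ∀ n : ℕ, SimpleGraph (Fin n) → Prop) : Prop :=
  Tendsto (fun n : ℕ => SimpleGraph.binomialRandom (Fin n) p {G | P n G}) atTop (𝓝 1)

/-- The real random variables `X n` on `G(n, p)` satisfy `X n = (c + o(1)) * n ^ a` with probability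
tending to `1`: for every `ε > 0`, `|X n - c * n ^ a| ≤ ε * n ^ a` with probability tending to `1`. -/
def AsymptoticWHP (p : unitInterval) (X : ∀ n : ℕ, SimpleGraph (Fin n) → ℝ) (c a : ℝ) : Prop :=
  ∀ ε : ℝ, 0 < ε →
    WithHighProbability p fun n G => |X n G - c * (n : ℝ) ^ a| ≤ ε * (n : ℝ) ^ a

/-! Typically all degrees are close to `np` and any two vertices have a common neighbour, so that `1
/ D(i,j)` is `1` on edges and `1/2` off them, that is `(1 + A i j) / 2` with `A` the adjacency
matrix. Hence both Harary matrices are close, in entrywise mean square, to `a n^k (1 + A i j)` off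
the diagonal, with `(a, k) = (p, 1)` and `(p² / 2, 2)`. Subtracting the mean of `A` gives `H = a n^k
σ √n • W + J + B`, where `σ² = p (1 - p)`, `W` is the centred adjacency matrix scaled to entry
variance `1 / n`, `J` is a multiple of all-ones minus identity, and `B` is the approximation error.

The energy is the nuclear norm, hence subadditive. `J` has energy `O(n^(k+1))`; so does `B` in mean,
by Cauchy–Schwarz and the second moments of its entries. Both are negligible against `n^(k+3/2)`,
and it remains to see that the energy of `W` divided by `n` tends to `8 / (3π)` in mean
(`tendsto_graphMean_abs_energy_sub`). The combination is `asymptoticWHP_matrixEnergy`.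

For `W` no convergence of spectral measures is needed. Since `|x| = (2/π) ∫₀^∞ x² / (x² + t²) dt`,
the energy is an integral over `t` of `n - t Im tr (W - it)⁻¹`. For fixed `t` the normalised trace
`m` nearly solves `1 + i t m + m² = 0`: averaging over a single edge gives the equation in mean
(`norm_graphMean_mul_resolvent_add_le`), and the Efron–Stein inequality (`graphMean_norm_sq_le`)
controls the fluctuations. Of the two roots, `Im m ≥ 0` selects the semicircle one
(`norm_sub_semicircle_le`). Dominated convergence in `t` and an explicit integral equal to `4/3`
give the constant `(2/π) (4/3) = 8 / (3π)`. -/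

theorem posSemidef_allOnes (V : Type*) [Fintype V] : (Matrix.of fun _ _ : V => (1 : ℝ)).PosSemidef := by
  have := Matrix.posSemidef_vecMulVec_self_star (fun _ : V => (1 : ℝ))
  convert this using 1
  ext i j
  simp [Matrix.vecMulVec_apply]

/-! ### Energy as the nuclear norm. -/

section Energy

variable {V : Type*} [Fintype V] [DecidableEq V]

theorem exists_unitary_diagonalization {A : Matrix V V ℝ} (hA : A.IsHermitian) :
    ∃ U ∈ Matrix.unitaryGroup V ℝ, A = U * Matrix.diagonal hA.eigenvalues * star U := by
  refine ⟨hA.eigenvectorUnitary.1, hA.eigenvectorUnitary.2, ?_⟩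
  conv_lhs => rw [hA.spectral_theorem, Unitary.conjStarAlgAut_apply]
  rfl

/-- In an eigenbasis of `A` the matrix `S` stays orthogonal, so its diagonal entries have modulus at
most `1`. Together with the next lemma this makes the energy the maximum of `tr (S A)` over
orthogonal `S`, from which the norm properties follow. -/
theorem abs_trace_mul_le_matrixEnergy {A S : Matrix V V ℝ} (hA : A.IsHermitian)
    (hS : S ∈ Matrix.unitaryGroup V ℝ) : |(S * A).trace| ≤ matrixEnergy A hA := by
  obtain ⟨U, hU, hUA⟩ := exists_unitary_diagonalization hA
  have h1 : (S * A).trace = ∑ i, (star U * S * U) i i * hA.eigenvalues i := by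
    conv_lhs => rw [hUA]
    rw [← mul_assoc, ← mul_assoc, Matrix.trace_mul_comm, ← mul_assoc, ← mul_assoc]
    simp [Matrix.trace, Matrix.mul_diagonal]
  rw [h1, matrixEnergy]
  refine (Finset.abs_sum_le_sum_abs _ _).trans (Finset.sum_le_sum fun i _ => ?_)
  rw [abs_mul]
  have h2 : star U * S * U ∈ Matrix.unitaryGroup V ℝ :=
    mul_mem (mul_mem (Unitary.star_mem hU) hS) hU
  have := entry_norm_bound_of_unitary h2 i i
  rw [Real.norm_eq_abs] at this
  exact mul_le_of_le_one_left (abs_nonneg _) this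

/-- The maximiser is the sign of `A`, with the sign at `0` set to `1` so that it remains orthogonal.
-/
theorem exists_trace_mul_eq_matrixEnergy {A : Matrix V V ℝ} (hA : A.IsHermitian) :
    ∃ S ∈ Matrix.unitaryGroup V ℝ, (S * A).trace = matrixEnergy A hA := by
  obtain ⟨U, hU, hUA⟩ := exists_unitary_diagonalization hA
  let s : V → ℝ := fun i => if 0 ≤ hA.eigenvalues i then 1 else -1
  have hs : Matrix.diagonal s ∈ Matrix.unitaryGroup V ℝ := by
    rw [Matrix.mem_unitaryGroup_iff, Matrix.star_eq_conjTranspose, Matrix.diagonal_conjTranspose,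
      Matrix.diagonal_mul_diagonal, ← Matrix.diagonal_one]
    congr 1
    ext i
    simp only [s, star_trivial]
    split_ifs <;> simp
  refine ⟨U * Matrix.diagonal s * star U, mul_mem (mul_mem hU hs) (Unitary.star_mem hU), ?_⟩
  conv_lhs => rw [hUA]
  have : U * Matrix.diagonal s * star U * (U * Matrix.diagonal hA.eigenvalues
      * star U) = U * (Matrix.diagonal s * Matrix.diagonal hA.eigenvalues)
      * star U := by
    have : star U * U = 1 := (Matrix.mem_unitaryGroup_iff').1 hU
    simp only [mul_assoc]
    rw [← mul_assoc (star U) U, this, one_mul]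
  rw [this, Matrix.trace_mul_comm, ← mul_assoc, (Matrix.mem_unitaryGroup_iff').1 hU, one_mul,
    Matrix.diagonal_mul_diagonal, Matrix.trace_diagonal, matrixEnergy]
  refine Finset.sum_congr rfl fun i _ => ?_
  simp only [s]
  split_ifs with h
  · simp [abs_of_nonneg h]
  · simp [abs_of_neg (not_le.1 h)]

theorem matrixEnergy_add_le {A B : Matrix V V ℝ} (hA : A.IsHermitian) (hB : B.IsHermitian)
    (hAB : (A + B).IsHermitian) :
    matrixEnergy (A + B) hAB ≤ matrixEnergy A hA + matrixEnergy B hB := by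
  obtain ⟨S, hS, h⟩ := exists_trace_mul_eq_matrixEnergy hAB
  rw [← h, mul_add, Matrix.trace_add]
  exact add_le_add ((le_abs_self _).trans (abs_trace_mul_le_matrixEnergy hA hS))
    ((le_abs_self _).trans (abs_trace_mul_le_matrixEnergy hB hS))

theorem matrixEnergy_nonneg {A : Matrix V V ℝ} (hA : A.IsHermitian) : 0 ≤ matrixEnergy A hA :=
  Finset.sum_nonneg fun _ _ => abs_nonneg _

theorem matrixEnergy_congr {A B : Matrix V V ℝ} (hA : A.IsHermitian) (hB : B.IsHermitian)
    (h : A = B) : matrixEnergy A hA = matrixEnergy B hB := by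
  subst h; rfl

theorem matrixEnergy_smul_le {A : Matrix V V ℝ} (hA : A.IsHermitian) (c : ℝ)
    (hcA : (c • A).IsHermitian) : matrixEnergy (c • A) hcA ≤ |c| * matrixEnergy A hA := by
  obtain ⟨S, hS, h⟩ := exists_trace_mul_eq_matrixEnergy hcA
  rw [← h, mul_smul_comm, Matrix.trace_smul, smul_eq_mul]
  refine (le_abs_self _).trans ?_
  rw [abs_mul]
  exact mul_le_mul_of_nonneg_left (abs_trace_mul_le_matrixEnergy hA hS) (abs_nonneg _)

theorem matrixEnergy_smul {A : Matrix V V ℝ} (hA : A.IsHermitian) (c : ℝ)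
    (hcA : (c • A).IsHermitian) : matrixEnergy (c • A) hcA = |c| * matrixEnergy A hA := by
  refine le_antisymm (matrixEnergy_smul_le hA c hcA) ?_
  obtain rfl | hc := eq_or_ne c 0
  · simpa using matrixEnergy_nonneg hcA
  have h1 : (c⁻¹ • (c • A)) = A := by rw [smul_smul, inv_mul_cancel₀ hc, one_smul]
  have h2 : (c⁻¹ • (c • A)).IsHermitian := by rwa [h1]
  have h3 := matrixEnergy_smul_le hcA c⁻¹ h2
  rw [matrixEnergy_congr h2 hA h1, abs_inv] at h3
  have := abs_pos.2 hc
  calc |c| * matrixEnergy A hA ≤ |c| * (|c|⁻¹ * matrixEnergy (c • A) hcA) := by gcongr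
    _ = _ := by field_simp

theorem abs_matrixEnergy_sub_le {A B C : Matrix V V ℝ} (hA : A.IsHermitian) (hB : B.IsHermitian)
    (hC : C.IsHermitian) (h : A = B + C) :
    |matrixEnergy A hA - matrixEnergy B hB| ≤ matrixEnergy C hC := by
  have hC' : ((-1 : ℝ) • C).IsHermitian := by
    have := hC.neg
    rwa [neg_one_smul]
  have h1 : matrixEnergy A hA ≤ matrixEnergy B hB + matrixEnergy C hC := by
    subst h
    exact matrixEnergy_add_le hB hC hA
  have h2 : B = A + (-1 : ℝ) • C := by rw [h]; simp
  have h3 : matrixEnergy B hB ≤ matrixEnergy A hA + matrixEnergy ((-1 : ℝ) • C) hC' := by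
    rw [matrixEnergy_congr hB (h2 ▸ hB) h2]
    exact matrixEnergy_add_le hA hC' _
  rw [matrixEnergy_smul hC] at h3
  rw [abs_le]
  constructor <;> simp at h3 <;> linarith

/-- Both sides are the trace of `A * A`. -/
theorem sum_sq_eigenvalues {A : Matrix V V ℝ} (hA : A.IsHermitian) :
    ∑ i, hA.eigenvalues i ^ 2 = ∑ i, ∑ j, A i j ^ 2 := by
  obtain ⟨U, hU, hUA⟩ := exists_unitary_diagonalization hA
  have h1 : (A * A).trace = ∑ i, hA.eigenvalues i ^ 2 := by
    have : A * A = U * (Matrix.diagonal hA.eigenvalues * Matrix.diagonal hA.eigenvalues)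
        * star U := by
      conv_lhs => rw [hUA]
      have : star U * U = 1 := (Matrix.mem_unitaryGroup_iff').1 hU
      simp only [mul_assoc]
      rw [← mul_assoc (star U) U, this, one_mul]
    rw [this, Matrix.trace_mul_comm, ← mul_assoc, (Matrix.mem_unitaryGroup_iff').1 hU, one_mul,
      Matrix.diagonal_mul_diagonal, Matrix.trace_diagonal]
    simp [sq]
  rw [← h1]
  simp only [Matrix.trace, Matrix.diag, Matrix.mul_apply]
  refine Finset.sum_congr rfl fun i _ => Finset.sum_congr rfl fun j _ => ?_
  rw [sq, ← hA.apply j i]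
  simp

theorem matrixEnergy_le_sqrt {A : Matrix V V ℝ} (hA : A.IsHermitian) :
    matrixEnergy A hA ≤ √(Fintype.card V * ∑ i, ∑ j, A i j ^ 2) := by
  refine Real.le_sqrt_of_sq_le ?_
  rw [← sum_sq_eigenvalues hA, matrixEnergy]
  have := sq_sum_le_card_mul_sum_sq (s := Finset.univ) (f := fun i => |hA.eigenvalues i|)
  simpa using this

theorem matrixEnergy_of_posSemidef {A : Matrix V V ℝ} (hA : A.PosSemidef) :
    matrixEnergy A hA.1 = A.trace := by
  rw [hA.1.trace_eq_sum_eigenvalues, matrixEnergy]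
  exact Finset.sum_congr rfl fun i _ => abs_of_nonneg (hA.eigenvalues_nonneg i)

/-- The all-ones matrix and the identity are both positive semidefinite, so each has energy equal to
its trace, the number of vertices. -/
theorem matrixEnergy_allOnes_sub_one_le (c : ℝ)
    (h : (c • ((Matrix.of fun _ _ : V => (1 : ℝ)) - 1)).IsHermitian) :
    matrixEnergy _ h ≤ |c| * (2 * Fintype.card V) := by
  have hJ := posSemidef_allOnes V
  have hI : (1 : Matrix V V ℝ).PosSemidef := Matrix.PosSemidef.one
  have hJI : ((Matrix.of fun _ _ : V => (1 : ℝ)) - 1).IsHermitian := hJ.1.sub hI.1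
  rw [matrixEnergy_smul hJI]
  refine mul_le_mul_of_nonneg_left ?_ (abs_nonneg _)
  have hI' : ((-1 : ℝ) • (1 : Matrix V V ℝ)).IsHermitian := by
    have := hI.1.neg
    rwa [neg_one_smul]
  have h1 : ((Matrix.of fun _ _ : V => (1 : ℝ)) - 1) =
      (Matrix.of fun _ _ : V => (1 : ℝ)) + (-1 : ℝ) • (1 : Matrix V V ℝ) := by
    rw [neg_one_smul, sub_eq_add_neg]
  rw [matrixEnergy_congr hJI (h1 ▸ hJI) h1]
  refine (matrixEnergy_add_le hJ.1 hI' _).trans ?_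
  rw [matrixEnergy_smul hI.1, matrixEnergy_of_posSemidef hJ, matrixEnergy_of_posSemidef hI]
  simp [Matrix.trace, two_mul]

end Energy

/-! ### Resolvents on the imaginary axis: Ward's identity and perturbation bounds. -/

section Resolvent

variable {V : Type*} [Fintype V] [DecidableEq V]

/-- The resolvent `(W - i t)⁻¹` of a real matrix `W` at the point `i t` of the imaginary axis. -/
noncomputable def imResolvent (W : Matrix V V ℝ) (t : ℝ) : Matrix V V ℂ :=
  (W.map Complex.ofReal - ((t : ℂ) * Complex.I) • 1)⁻¹

theorem ofReal_sub_mul_I_ne_zero (x : ℝ) {t : ℝ} (ht : 0 < t) :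
    (x : ℂ) - (t : ℂ) * Complex.I ≠ 0 := by
  intro h
  have := congrArg Complex.im h
  simp at this
  exact ht.ne' this

theorem exists_imResolvent_diagonalization {W : Matrix V V ℝ} (hW : W.IsHermitian) {t : ℝ}
    (ht : 0 < t) : ∃ U : Matrix V V ℂ, star U * U = 1 ∧
      (W.map Complex.ofReal - ((t : ℂ) * Complex.I) • 1) *
        (U * Matrix.diagonal (fun i => ((hW.eigenvalues i : ℂ) - (t : ℂ) * Complex.I)⁻¹) * star U)
        = 1 := by
  obtain ⟨U, hU, hUW⟩ := exists_unitary_diagonalization hW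
  have h1 : (U.map Complex.ofReal) * star (U.map Complex.ofReal) = 1 := by
    have := congrArg (fun M : Matrix V V ℝ => M.map Complex.ofReal) (Matrix.mem_unitaryGroup_iff.1 hU)
    ext i j
    have := congrFun (congrFun this i) j
    simp only [Matrix.map_apply, Matrix.mul_apply, Matrix.star_apply] at this ⊢
    push_cast at this
    rw [Matrix.one_apply] at *
    split_ifs at * <;> simpa using this
  have h2 : star (U.map Complex.ofReal) * (U.map Complex.ofReal) = 1 := mul_eq_one_comm.1 h1
  refine ⟨U.map Complex.ofReal, h2, ?_⟩
  set U' := U.map Complex.ofReal with hU'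
  have h3 : W.map Complex.ofReal =
      U' * Matrix.diagonal (fun i => (hW.eigenvalues i : ℂ)) * star U' := by
    conv_lhs => rw [hUW]
    ext i j
    simp [Matrix.mul_apply, Matrix.diagonal_apply, hU']
  have h4 : W.map Complex.ofReal - ((t : ℂ) * Complex.I) • 1 =
      U' * Matrix.diagonal (fun i => (hW.eigenvalues i : ℂ) - (t : ℂ) * Complex.I) * star U' := by
    have : Matrix.diagonal (fun i => (hW.eigenvalues i : ℂ) - (t : ℂ) * Complex.I) =
      Matrix.diagonal (fun i => (hW.eigenvalues i : ℂ)) - ((t : ℂ) * Complex.I) • 1 := by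
      rw [Matrix.smul_one_eq_diagonal, Matrix.diagonal_sub]
    rw [this, mul_sub, sub_mul, ← h3, mul_smul_comm, mul_one, smul_mul_assoc, h1]
  rw [h4]
  simp only [mul_assoc]
  rw [← mul_assoc (star U') U', h2, one_mul, ← mul_assoc (Matrix.diagonal _) (Matrix.diagonal _),
    Matrix.diagonal_mul_diagonal]
  have : (fun i => ((hW.eigenvalues i : ℂ) - (t : ℂ) * Complex.I) *
      ((hW.eigenvalues i : ℂ) - (t : ℂ) * Complex.I)⁻¹) = fun _ => 1 :=
    funext fun i => mul_inv_cancel₀ (ofReal_sub_mul_I_ne_zero _ ht)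
  rw [this, Matrix.diagonal_one, one_mul, h1]

theorem sub_smul_mul_imResolvent {W : Matrix V V ℝ} (hW : W.IsHermitian) {t : ℝ} (ht : 0 < t) :
    (W.map Complex.ofReal - ((t : ℂ) * Complex.I) • 1) * imResolvent W t = 1 := by
  obtain ⟨U, -, h⟩ := exists_imResolvent_diagonalization hW ht
  rw [imResolvent, Matrix.inv_eq_right_inv h, h]

theorem imResolvent_mul_sub_smul {W : Matrix V V ℝ} (hW : W.IsHermitian) {t : ℝ} (ht : 0 < t) :
    imResolvent W t * (W.map Complex.ofReal - ((t : ℂ) * Complex.I) • 1) = 1 :=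
  mul_eq_one_comm.1 (sub_smul_mul_imResolvent hW ht)

theorem map_mul_imResolvent {W : Matrix V V ℝ} (hW : W.IsHermitian) {t : ℝ} (ht : 0 < t) :
    W.map Complex.ofReal * imResolvent W t =
      1 + ((t : ℂ) * Complex.I) • imResolvent W t := by
  have := sub_smul_mul_imResolvent hW ht
  rw [sub_mul, smul_mul_assoc, one_mul] at this
  rw [← this]; simp

theorem trace_imResolvent {W : Matrix V V ℝ} (hW : W.IsHermitian) {t : ℝ} (ht : 0 < t) :
    (imResolvent W t).trace = ∑ i, ((hW.eigenvalues i : ℂ) - (t : ℂ) * Complex.I)⁻¹ := by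
  obtain ⟨U, hU, h⟩ := exists_imResolvent_diagonalization hW ht
  rw [imResolvent, Matrix.inv_eq_right_inv h, Matrix.trace_mul_comm, ← mul_assoc, hU, one_mul,
    Matrix.trace_diagonal]

/-- This is the link between the resolvent and the integral formula for the energy: `Im (x - it)⁻¹ =
t / (x² + t²)`. -/
theorem im_trace_imResolvent {W : Matrix V V ℝ} (hW : W.IsHermitian) {t : ℝ} (ht : 0 < t) :
    (imResolvent W t).trace.im = ∑ i, t / (hW.eigenvalues i ^ 2 + t ^ 2) := by
  rw [trace_imResolvent hW ht, Complex.im_sum]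
  refine Finset.sum_congr rfl fun i _ => ?_
  rw [Complex.inv_im, Complex.normSq_apply]
  simp [sq]

theorem imResolvent_transpose {W : Matrix V V ℝ} (hW : W.IsHermitian) (t : ℝ) :
    (imResolvent W t).transpose = imResolvent W t := by
  have : W.transpose = W := by simpa [Matrix.conjTranspose_eq_transpose_of_trivial] using hW.eq
  rw [imResolvent, Matrix.transpose_nonsing_inv, Matrix.transpose_sub, Matrix.transpose_smul,
    Matrix.transpose_one, ← Matrix.transpose_map, this]

theorem imResolvent_comm {W : Matrix V V ℝ} (hW : W.IsHermitian) (t : ℝ) (i j : V) :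
    imResolvent W t i j = imResolvent W t j i :=
  congrFun (congrFun (imResolvent_transpose hW t) j) i

theorem imResolvent_sub {W₀ W₁ : Matrix V V ℝ} (h₀ : W₀.IsHermitian) (h₁ : W₁.IsHermitian)
    {t : ℝ} (ht : 0 < t) : imResolvent W₁ t - imResolvent W₀ t =
      - (imResolvent W₀ t * ((W₁ - W₀).map Complex.ofReal) * imResolvent W₁ t) := by
  have h : (W₁ - W₀).map Complex.ofReal = (W₁.map Complex.ofReal - ((t : ℂ) * Complex.I) • 1) -
      (W₀.map Complex.ofReal - ((t : ℂ) * Complex.I) • 1) := by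
    ext i j; simp
  rw [h, mul_sub, imResolvent_mul_sub_smul h₀ ht, sub_mul, mul_assoc,
    sub_smul_mul_imResolvent h₁ ht]
  simp

/-- Ward's identity. -/
theorem sum_norm_sq_imResolvent {W : Matrix V V ℝ} (hW : W.IsHermitian) {t : ℝ} (ht : 0 < t)
    (i : V) : t * ∑ j, ‖imResolvent W t i j‖ ^ 2 = (imResolvent W t i i).im := by
  set R := imResolvent W t with hR
  -- The adjoint of `W - it` is `W + it = (W - it) + 2it`; multiplying by `R` and its adjoint gives
  -- `R - R* = 2it R R*`, whose diagonal entries are the claim.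
  have hWt : (W.map Complex.ofReal - ((t : ℂ) * Complex.I) • 1).conjTranspose =
      (W.map Complex.ofReal - ((t : ℂ) * Complex.I) • 1) + (2 * ((t : ℂ) * Complex.I)) • 1 := by
    ext i j
    have := hW.apply i j
    simp only [star_trivial] at this
    by_cases hij : i = j
    · subst hij
      simp
      ring
    · simp [hij, Ne.symm hij, this]
  have h1 : R * (W.map Complex.ofReal - ((t : ℂ) * Complex.I) • 1) = 1 :=
    imResolvent_mul_sub_smul hW ht
  have h2 : (W.map Complex.ofReal - ((t : ℂ) * Complex.I) • 1).conjTranspose *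
      R.conjTranspose = 1 := by
    rw [← Matrix.conjTranspose_mul, h1, Matrix.conjTranspose_one]
  rw [hWt] at h2
  have h3 : R = R.conjTranspose + (2 * ((t : ℂ) * Complex.I)) • (R * R.conjTranspose) := by
    calc R = R * 1 := (mul_one _).symm
      _ = _ := by rw [← h2, add_mul, mul_add, ← mul_assoc, h1, one_mul, smul_mul_assoc, one_mul,
                    mul_smul_comm]
  have h4 := congrFun (congrFun h3 i) i
  have h5 : (R * R.conjTranspose) i i = ((∑ j, ‖R i j‖ ^ 2 : ℝ) : ℂ) := by
    rw [Matrix.mul_apply]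
    push_cast
    refine Finset.sum_congr rfl fun j _ => ?_
    rw [Matrix.conjTranspose_apply, Complex.star_def, Complex.mul_conj, Complex.normSq_eq_norm_sq]
    push_cast; rfl
  rw [Matrix.add_apply, Matrix.smul_apply, h5, Matrix.conjTranspose_apply] at h4
  have h6 := congrArg Complex.im h4
  simp at h6
  simp only [← Complex.ofReal_pow, Complex.ofReal_re] at h6
  linarith

/-- Ward's identity gives `t |R i j|² ≤ |R i i|`; the case `j = i` bounds the diagonal, and then
every entry. -/
theorem norm_imResolvent_le {W : Matrix V V ℝ} (hW : W.IsHermitian) {t : ℝ} (ht : 0 < t)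
    (i j : V) : ‖imResolvent W t i j‖ ≤ t⁻¹ := by
  have key : ∀ j, ‖imResolvent W t i j‖ ^ 2 ≤ t⁻¹ * ‖imResolvent W t i i‖ := by
    intro j
    rw [← div_eq_inv_mul, le_div_iff₀ ht, mul_comm]
    calc t * ‖imResolvent W t i j‖ ^ 2 ≤ t * ∑ j, ‖imResolvent W t i j‖ ^ 2 := by
          gcongr
          exact Finset.single_le_sum (f := fun j => ‖imResolvent W t i j‖ ^ 2)
            (fun _ _ => sq_nonneg _) (Finset.mem_univ j)
      _ = (imResolvent W t i i).im := sum_norm_sq_imResolvent hW ht i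
      _ ≤ _ := (le_abs_self _).trans (Complex.abs_im_le_norm _)
  have hii : ‖imResolvent W t i i‖ ≤ t⁻¹ := by
    by_contra! h
    have h0 : 0 < ‖imResolvent W t i i‖ := lt_trans (inv_pos.2 ht) h
    have := key i
    nlinarith
  have h1 := key j
  have : ‖imResolvent W t i j‖ ^ 2 ≤ t⁻¹ ^ 2 := by
    refine h1.trans ?_
    rw [sq]
    exact mul_le_mul_of_nonneg_left hii (inv_pos.2 ht).le
  exact (sq_le_sq₀ (norm_nonneg _) (inv_pos.2 ht).le).1 this

theorem sum_norm_sq_imResolvent_le {W : Matrix V V ℝ} (hW : W.IsHermitian) {t : ℝ} (ht : 0 < t)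
    (i : V) : ∑ j, ‖imResolvent W t i j‖ ^ 2 ≤ t⁻¹ ^ 2 := by
  have h1 := sum_norm_sq_imResolvent hW ht i
  have h2 := (le_abs_self _).trans ((Complex.abs_im_le_norm _).trans
    (norm_imResolvent_le hW ht i i))
  rw [← h1] at h2
  calc ∑ j, ‖imResolvent W t i j‖ ^ 2 = t⁻¹ * (t * ∑ j, ‖imResolvent W t i j‖ ^ 2) := by
        field_simp
    _ ≤ t⁻¹ * t⁻¹ := by gcongr
    _ = _ := (sq _).symm

theorem norm_mul_imResolvent_le {W₀ W₁ : Matrix V V ℝ} (h₀ : W₀.IsHermitian)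
    (h₁ : W₁.IsHermitian) {t : ℝ} (ht : 0 < t) (i j : V) :
    ‖(imResolvent W₁ t * imResolvent W₀ t) i j‖ ≤ t⁻¹ ^ 2 := by
  rw [Matrix.mul_apply]
  refine (norm_sum_le _ _).trans ?_
  have h : ∀ k, ‖imResolvent W₁ t i k * imResolvent W₀ t k j‖ ≤
      (‖imResolvent W₁ t i k‖ ^ 2 + ‖imResolvent W₀ t j k‖ ^ 2) / 2 := by
    intro k
    rw [norm_mul, imResolvent_comm h₀ t k j]
    nlinarith [sq_nonneg (‖imResolvent W₁ t i k‖ - ‖imResolvent W₀ t j k‖)]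
  refine (Finset.sum_le_sum fun k _ => h k).trans ?_
  rw [← Finset.sum_div, Finset.sum_add_distrib]
  linarith [sum_norm_sq_imResolvent_le h₁ ht i, sum_norm_sq_imResolvent_le h₀ ht j]

/-- The matrix with entries `1` at `(i, j)` and `(j, i)` for distinct `i` and `j`. -/
def symmSingle (i j : V) : Matrix V V ℝ := Matrix.single i j 1 + Matrix.single j i 1

theorem mul_symmSingle_mul_apply (A B : Matrix V V ℂ) (i j k l : V) :
    (A * (symmSingle i j).map Complex.ofReal * B) k l = A k i * B j l + A k j * B i l := by
  have : (symmSingle i j).map Complex.ofReal = Matrix.single i j (1 : ℂ) + Matrix.single j i 1 := by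
    ext a b
    simp [symmSingle, Matrix.single_apply, apply_ite Complex.ofReal]
  rw [this, mul_add, add_mul, Matrix.add_apply]
  simp [Matrix.mul_apply, Matrix.single_apply, ite_and, Finset.sum_ite_eq]

theorem imResolvent_sub_apply {W₀ W₁ : Matrix V V ℝ} (h₀ : W₀.IsHermitian) (h₁ : W₁.IsHermitian)
    {t : ℝ} (ht : 0 < t) {δ : ℝ} {i j : V} (h : W₁ - W₀ = δ • symmSingle i j) (k l : V) :
    imResolvent W₁ t k l - imResolvent W₀ t k l =
      - ((δ : ℂ) * (imResolvent W₀ t k i * imResolvent W₁ t j l +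
        imResolvent W₀ t k j * imResolvent W₁ t i l)) := by
  have := congrFun (congrFun (imResolvent_sub h₀ h₁ ht) k) l
  rw [Matrix.sub_apply] at this
  rw [this, h, Matrix.neg_apply, ← mul_symmSingle_mul_apply]
  have : (δ • symmSingle i j).map Complex.ofReal =
      (δ : ℂ) • (symmSingle i j).map Complex.ofReal := by
    ext; simp
  rw [this, mul_smul_comm, smul_mul_assoc]
  simp

theorem norm_imResolvent_sub_le {W₀ W₁ : Matrix V V ℝ} (h₀ : W₀.IsHermitian)
    (h₁ : W₁.IsHermitian) {t : ℝ} (ht : 0 < t) {δ : ℝ} (hδ : 0 ≤ δ) {i j : V}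
    (h : W₁ - W₀ = δ • symmSingle i j) (k l : V) :
    ‖imResolvent W₁ t k l - imResolvent W₀ t k l‖ ≤ 2 * δ * t⁻¹ ^ 2 := by
  rw [imResolvent_sub_apply h₀ h₁ ht h, norm_neg, norm_mul, Complex.norm_real, Real.norm_eq_abs,
    abs_of_nonneg hδ, mul_comm 2 δ, mul_assoc]
  refine mul_le_mul_of_nonneg_left ((norm_add_le _ _).trans ?_) hδ
  rw [norm_mul, norm_mul, two_mul, sq]
  gcongr <;> first | exact norm_imResolvent_le h₀ ht _ _ | exact norm_imResolvent_le h₁ ht _ _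

/-- Summing the entrywise formula over the diagonal assembles entries of the product `R₁ R₀`, which
are bounded by `t⁻¹ ^ 2`. The bound is therefore free of the dimension, which a sum of the entrywise
bounds would not be. -/
theorem norm_trace_imResolvent_sub_le {W₀ W₁ : Matrix V V ℝ} (h₀ : W₀.IsHermitian)
    (h₁ : W₁.IsHermitian) {t : ℝ} (ht : 0 < t) {δ : ℝ} (hδ : 0 ≤ δ) {i j : V}
    (h : W₁ - W₀ = δ • symmSingle i j) :
    ‖(imResolvent W₁ t).trace - (imResolvent W₀ t).trace‖ ≤ 2 * δ * t⁻¹ ^ 2 := by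
  have : (imResolvent W₁ t).trace - (imResolvent W₀ t).trace =
      - ((δ : ℂ) * ((imResolvent W₁ t * imResolvent W₀ t) j i +
        (imResolvent W₁ t * imResolvent W₀ t) i j)) := by
    simp only [Matrix.trace, Matrix.diag, ← Finset.sum_sub_distrib, imResolvent_sub_apply h₀ h₁ ht h]
    rw [Finset.sum_neg_distrib, ← Finset.mul_sum, Finset.sum_add_distrib, Matrix.mul_apply,
      Matrix.mul_apply]
    simp only [mul_comm]
  rw [this, norm_neg, norm_mul, Complex.norm_real, Real.norm_eq_abs, abs_of_nonneg hδ,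
    mul_comm 2 δ, mul_assoc]
  refine mul_le_mul_of_nonneg_left ((norm_add_le _ _).trans ?_) hδ
  rw [two_mul]
  exact add_le_add (norm_mul_imResolvent_le h₀ h₁ ht _ _) (norm_mul_imResolvent_le h₀ h₁ ht _ _)

end Resolvent

/-! ### The two explicit integrals. -/

section Integrals
open MeasureTheory Set

theorem integral_sq_div_sq_add_sq (x : ℝ) :
    IntegrableOn (fun t : ℝ => x ^ 2 / (x ^ 2 + t ^ 2)) (Ioi 0) ∧
      ∫ t in Ioi (0 : ℝ), x ^ 2 / (x ^ 2 + t ^ 2) = Real.pi / 2 * |x| := by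
  obtain rfl | hx := eq_or_ne x 0
  · simp
  have hx' := abs_pos.2 hx
  have hd : ∀ t ∈ Ici (0 : ℝ), HasDerivAt (fun t => |x| * Real.arctan (t / |x|))
      (x ^ 2 / (x ^ 2 + t ^ 2)) t := by
    intro t _
    have h1 := (((hasDerivAt_id t).div_const |x|).arctan).const_mul |x|
    refine h1.congr_deriv ?_
    have : x ^ 2 = |x| ^ 2 := (sq_abs x).symm
    rw [this]
    simp only [id]
    field_simp
  have hlim : Tendsto (fun t => |x| * Real.arctan (t / |x|)) atTop (𝓝 (|x| * (Real.pi / 2))) := by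
    refine Tendsto.const_mul _ ?_
    have h2 : Tendsto Real.arctan atTop (𝓝 (Real.pi / 2)) :=
      Real.tendsto_arctan_atTop.mono_right nhdsWithin_le_nhds
    exact h2.comp (tendsto_id.atTop_div_const hx')
  have hnn : ∀ t ∈ Ioi (0 : ℝ), 0 ≤ x ^ 2 / (x ^ 2 + t ^ 2) := fun t _ => by positivity
  refine ⟨integrableOn_Ioi_deriv_of_nonneg' hd hnn hlim, ?_⟩
  rw [integral_Ioi_of_hasDerivAt_of_nonneg' hd hnn hlim]
  simp [mul_comm]

theorem sqrt_sq_add_four_sub_le {t : ℝ} (ht : 0 < t) :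
    0 ≤ √(t ^ 2 + 4) - t ∧ √(t ^ 2 + 4) - t ≤ 2 / t := by
  have h : √(t ^ 2 + 4) ≤ t + 2 / t := by
    refine Real.sqrt_le_iff.2 ⟨by positivity, ?_⟩
    have : (t + 2 / t) ^ 2 = t ^ 2 + 4 + (2 / t) ^ 2 := by field_simp; ring
    rw [this]
    nlinarith [sq_nonneg (2 / t)]
  have h' : t ≤ √(t ^ 2 + 4) := Real.le_sqrt_of_sq_le (by linarith)
  constructor <;> linarith

/-- An antiderivative is `t + t³/6 - (t² + 4)^(3/2) / 6`. It equals `-4/3` at `0` and vanishes at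
infinity. -/
theorem integral_one_sub_semicircle :
    IntegrableOn (fun t : ℝ => 1 - t * ((√(t ^ 2 + 4) - t) / 2)) (Ioi 0) ∧
      ∫ t in Ioi (0 : ℝ), (1 - t * ((√(t ^ 2 + 4) - t) / 2)) = 4 / 3 := by
  have hd : ∀ t ∈ Ici (0 : ℝ), HasDerivAt (fun t => t + t ^ 3 / 6 - √(t ^ 2 + 4) ^ 3 / 6)
      (1 - t * ((√(t ^ 2 + 4) - t) / 2)) t := by
    intro t _
    have hpos : 0 < t ^ 2 + 4 := by positivity
    have h1 := (((hasDerivAt_pow 2 t).add_const 4).sqrt hpos.ne').pow 3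
    have h2 := ((hasDerivAt_id t).add ((hasDerivAt_pow 3 t).div_const 6)).sub (h1.div_const 6)
    have hs := Real.sqrt_pos.2 hpos
    refine HasDerivAt.congr_deriv h2 ?_
    field_simp
    push_cast
    ring
  have hlim : Tendsto (fun t => t + t ^ 3 / 6 - √(t ^ 2 + 4) ^ 3 / 6) atTop (𝓝 0) := by
    have hb : Tendsto (fun t => √(t ^ 2 + 4) - t) atTop (𝓝 0) := by
      refine tendsto_of_tendsto_of_tendsto_of_le_of_le' tendsto_const_nhds
        (tendsto_const_nhds.div_atTop tendsto_id : Tendsto (fun t : ℝ => 2 / t) atTop (𝓝 0)) ?_ ?_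
      · filter_upwards [eventually_gt_atTop 0] with t ht using (sqrt_sq_add_four_sub_le ht).1
      · filter_upwards [eventually_gt_atTop 0] with t ht using (sqrt_sq_add_four_sub_le ht).2
    -- With `b = √(t² + 4) - t`, the relation `b (b + 2t) = 4` turns the antiderivative into the
    -- polynomial `-(3b + b³/4) / 6`, and `b` tends to `0`.
    have h : Tendsto (fun t => -(3 * (√(t ^ 2 + 4) - t) + (√(t ^ 2 + 4) - t) ^ 3 / 4) / 6) atTop
        (𝓝 (-(3 * 0 + 0 ^ 3 / 4) / 6)) :=
      (((hb.const_mul 3).add ((hb.pow 3).div_const 4)).neg).div_const 6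
    have h0 : -(3 * 0 + 0 ^ 3 / 4) / 6 = (0 : ℝ) := by norm_num
    rw [h0] at h
    refine h.congr fun t => ?_
    have hs := Real.sq_sqrt (show (0 : ℝ) ≤ t ^ 2 + 4 by positivity)
    set a := √(t ^ 2 + 4)
    linear_combination (a / 8 + t / 8) * hs
  have hnn : ∀ t ∈ Ioi (0 : ℝ), 0 ≤ 1 - t * ((√(t ^ 2 + 4) - t) / 2) := by
    intro t ht
    have ht' : (0 : ℝ) < t := ht
    have := mul_le_mul_of_nonneg_left (sqrt_sq_add_four_sub_le ht').2 ht'.le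
    rw [mul_div_cancel₀ _ ht'.ne'] at this
    linarith
  refine ⟨integrableOn_Ioi_deriv_of_nonneg' hd hnn hlim, ?_⟩
  rw [integral_Ioi_of_hasDerivAt_of_nonneg' hd hnn hlim]
  have : √(0 ^ 2 + 4) = 2 := by
    rw [show (0 : ℝ) ^ 2 + 4 = 2 ^ 2 by norm_num, Real.sqrt_sq (by norm_num)]
  rw [this]
  norm_num

end Integrals

/-! ### Expectation on `G(n, p)`, resampling of one edge, and variance bounds. -/

section RandomGraph

variable {V : Type*}

/-- The graph obtained from `G` by making `e` an edge if `b` holds, and a non-edge otherwise. -/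
def setEdge (G : SimpleGraph V) (e : Sym2 V) (b : Prop) : SimpleGraph V where
  Adj u v := u ≠ v ∧ ((s(u, v) = e ∧ b) ∨ (s(u, v) ≠ e ∧ G.Adj u v))
  symm := ⟨fun u v h => by rwa [Sym2.eq_swap, G.adj_comm, ne_comm]⟩
  loopless := ⟨fun _ h => h.1 rfl⟩

theorem setEdge_adj (G : SimpleGraph V) (e : Sym2 V) (b : Prop) (u v : V) :
    (setEdge G e b).Adj u v ↔ u ≠ v ∧ ((s(u, v) = e ∧ b) ∨ (s(u, v) ≠ e ∧ G.Adj u v)) := Iff.rfl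

theorem setEdge_setEdge (G : SimpleGraph V) (e : Sym2 V) (b c : Prop) :
    setEdge (setEdge G e c) e b = setEdge G e b := by
  ext u v
  simp only [setEdge_adj]
  tauto

theorem setEdge_comm (G : SimpleGraph V) {e e' : Sym2 V} (h : e ≠ e') (b c : Prop) :
    setEdge (setEdge G e' c) e b = setEdge (setEdge G e b) e' c := by
  ext u v
  simp only [setEdge_adj]
  by_cases h1 : s(u, v) = e
  · have : s(u, v) ≠ e' := h1 ▸ h
    tauto
  · tauto

theorem setEdge_of_isDiag (G : SimpleGraph V) {e : Sym2 V} (h : e.IsDiag) (b : Prop) :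
    setEdge G e b = G := by
  ext u v
  simp only [setEdge_adj]
  have : u ≠ v → s(u, v) ≠ e := by
    rintro huv rfl
    exact huv (by simpa using h)
  have := G.ne_of_adj (a := u) (b := v)
  tauto

theorem setEdge_mem (G : SimpleGraph V) (e : Sym2 V) : setEdge G e (e ∈ G.edgeSet) = G := by
  ext u v
  simp only [setEdge_adj]
  have h := G.ne_of_adj (a := u) (b := v)
  by_cases h1 : s(u, v) = e
  · subst h1
    simp only [SimpleGraph.mem_edgeSet]
    tauto
  · tauto

theorem mem_edgeSet_setEdge (G : SimpleGraph V) {e : Sym2 V} (he : ¬ e.IsDiag) (b : Prop) :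
    e ∈ (setEdge G e b).edgeSet ↔ b := by
  induction e with | _ u v
  have : u ≠ v := by simpa using he
  simp [setEdge_adj, this]

theorem edgeSet_setEdge_true (G : SimpleGraph V) {e : Sym2 V} (he : ¬ e.IsDiag) :
    (setEdge G e True).edgeSet = insert e (setEdge G e False).edgeSet := by
  ext e'
  by_cases h : e' = e
  · subst h
    simp [mem_edgeSet_setEdge G he]
  · induction e' with | _ u v
    simp [setEdge_adj, h]

theorem SimpleGraph.measurableSingletonClass [Countable V] :
    MeasurableSingletonClass (SimpleGraph V) where
  measurableSet_singleton G := by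
    have h : ({G} : Set (SimpleGraph V)) = SimpleGraph.edgeSet ⁻¹' {G.edgeSet} := by
      ext H
      simp
    rw [h]
    exact SimpleGraph.measurable_edgeSet (MeasurableSet.singleton _)

variable [Fintype V]

open SimpleGraph in
-- Switching one pair on or off changes the probability in the ratio `p : (1 - p)`. Independence of
-- the edges enters the whole argument only through this identity, stated without division so that
-- `p = 0` and `p = 1` are allowed.
theorem binomialRandom_setEdge (p : unitInterval) (G : SimpleGraph V) {e : Sym2 V}
    (he : ¬ e.IsDiag) :
    (1 - (p : ℝ)) * (binomialRandom V p).real {setEdge G e True} =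
      p * (binomialRandom V p).real {setEdge G e False} := by
  classical
  have hmem : e ∉ (setEdge G e False).edgeSet := by simp [mem_edgeSet_setEdge G he]
  have h1 : (setEdge G e True).edgeSet.ncard = (setEdge G e False).edgeSet.ncard + 1 := by
    rw [edgeSet_setEdge_true G he, Set.ncard_insert_of_notMem hmem]
  have h2 : (setEdge G e True).edgeSet.ncard ≤ (Nat.card V).choose 2 := by
    have := (setEdge G e True).card_edgeFinset_le_card_choose_two
    rwa [← SimpleGraph.coe_edgeFinset, Set.ncard_coe_finset, Nat.card_eq_fintype_card]
  rw [MeasureTheory.measureReal_def, MeasureTheory.measureReal_def, binomialRandom_singleton,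
    binomialRandom_singleton]
  simp only [ENNReal.toReal_mul, ENNReal.toReal_pow, ENNReal.coe_toReal,
    unitInterval.coe_toNNReal, unitInterval.coe_symm_eq]
  rw [h1] at h2 ⊢
  obtain ⟨m, hm⟩ := Nat.exists_eq_add_of_le h2
  rw [hm, show (setEdge G e False).edgeSet.ncard + 1 + m - ((setEdge G e False).edgeSet.ncard + 1)
    = m by omega, show (setEdge G e False).edgeSet.ncard + 1 + m - (setEdge G e False).edgeSet.ncard
    = m + 1 by omega]
  ring

variable [DecidableEq V] {E : Type*} [NormedAddCommGroup E] [NormedSpace ℝ E]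

/-- The expectation of a random variable on the binomial random graph. -/
noncomputable def graphMean (p : unitInterval) (f : SimpleGraph V → E) : E :=
  ∑ G : SimpleGraph V, (SimpleGraph.binomialRandom V p).real {G} • f G

/-- The conditional expectation given the status of all pairs of vertices other than `e`. -/
def edgeMean (p : unitInterval) (e : Sym2 V) (f : SimpleGraph V → E) (G : SimpleGraph V) : E :=
  (p : ℝ) • f (setEdge G e True) + (1 - (p : ℝ)) • f (setEdge G e False)

variable (p : unitInterval)

theorem sum_binomialRandom_singleton :
    ∑ G : SimpleGraph V, (SimpleGraph.binomialRandom V p).real {G} = 1 := by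
  have := SimpleGraph.measurableSingletonClass (V := V)
  simp

theorem graphMean_const (c : E) : graphMean p (fun _ : SimpleGraph V => c) = c := by
  rw [graphMean, ← Finset.sum_smul, sum_binomialRandom_singleton, one_smul]

theorem graphMean_add (f g : SimpleGraph V → E) :
    graphMean p (fun G => f G + g G) = graphMean p f + graphMean p g := by
  simp [graphMean, Finset.sum_add_distrib]

theorem graphMean_sub (f g : SimpleGraph V → E) :
    graphMean p (fun G => f G - g G) = graphMean p f - graphMean p g := by
  simp [graphMean, smul_sub, Finset.sum_sub_distrib]

theorem graphMean_sum {ι : Type*} (s : Finset ι) (f : ι → SimpleGraph V → E) :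
    graphMean p (fun G => ∑ i ∈ s, f i G) = ∑ i ∈ s, graphMean p (f i) := by
  simp only [graphMean, Finset.smul_sum]
  exact Finset.sum_comm

theorem graphMean_mul_left {𝕜 : Type*} [RCLike 𝕜] (c : 𝕜) (f : SimpleGraph V → 𝕜) :
    graphMean p (fun G => c * f G) = c * graphMean p f := by
  simp only [graphMean, Finset.mul_sum]
  exact Finset.sum_congr rfl fun G _ => (mul_smul_comm _ _ _).symm

theorem graphMean_mono {f g : SimpleGraph V → ℝ} (h : ∀ G, f G ≤ g G) :
    graphMean p f ≤ graphMean p g :=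
  Finset.sum_le_sum fun G _ => smul_le_smul_of_nonneg_left (h G) MeasureTheory.measureReal_nonneg

theorem graphMean_nonneg {f : SimpleGraph V → ℝ} (h : ∀ G, 0 ≤ f G) : 0 ≤ graphMean p f :=
  Finset.sum_nonneg fun G _ => smul_nonneg MeasureTheory.measureReal_nonneg (h G)

theorem norm_graphMean_le (f : SimpleGraph V → E) :
    ‖graphMean p f‖ ≤ graphMean p fun G => ‖f G‖ := by
  refine (norm_sum_le _ _).trans (Finset.sum_le_sum fun G _ => ?_)
  rw [norm_smul, Real.norm_eq_abs, abs_of_nonneg MeasureTheory.measureReal_nonneg, smul_eq_mul]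

theorem graphMean_sq_le (f : SimpleGraph V → ℝ) :
    graphMean p f ^ 2 ≤ graphMean p fun G => f G ^ 2 := by
  have h := graphMean_nonneg p (f := fun G => (f G - graphMean p f) ^ 2) fun G => sq_nonneg _
  have h2 : (graphMean p fun G => (f G - graphMean p f) ^ 2) =
      (graphMean p fun G => f G ^ 2) - graphMean p f ^ 2 := by
    have : (fun G => (f G - graphMean p f) ^ 2) =
        fun G => f G ^ 2 - 2 * graphMean p f * f G + graphMean p f ^ 2 := by
      ext G; ring
    rw [this, graphMean_add, graphMean_sub, graphMean_mul_left, graphMean_const]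
    ring
  linarith

/-- This is the tower property for conditioning on all pairs but `e`. It is proved by pairing each
graph with the one in which `e` is toggled. -/
theorem graphMean_edgeMean (e : Sym2 V) (f : SimpleGraph V → E) :
    graphMean p (edgeMean p e f) = graphMean p f := by
  classical
  by_cases he : e.IsDiag
  · have : edgeMean p e f = f := by
      ext G
      rw [edgeMean, setEdge_of_isDiag G he, setEdge_of_isDiag G he, ← add_smul]
      simp
    rw [this]
  let τ : SimpleGraph V → SimpleGraph V := fun G => setEdge G e (e ∉ G.edgeSet)
  have hτ : Function.Involutive τ := by
    intro G
    simp only [τ]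
    rw [setEdge_setEdge, mem_edgeSet_setEdge G he, not_not, setEdge_mem]
  let w : SimpleGraph V → ℝ := fun G => (SimpleGraph.binomialRandom V p).real {G}
  -- The weight `κ G` is the mass that averaging moves from `f G` to `f (τ G)`. It is invariant
  -- under `τ`, so the gains and losses cancel in the sum over all graphs.
  let κ : SimpleGraph V → ℝ := fun G => if e ∈ G.edgeSet then (1 - (p : ℝ)) * w G else p * w G
  have hτmem : ∀ G, e ∈ (τ G).edgeSet ↔ e ∉ G.edgeSet := fun G => mem_edgeSet_setEdge G he _
  have htrue : ∀ G, e ∈ G.edgeSet → setEdge G e True = G ∧ setEdge G e False = τ G := by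
    intro G hG
    have := setEdge_mem G e
    simp only [hG] at this
    exact ⟨this, by simp [τ, hG]⟩
  have hfalse : ∀ G, e ∉ G.edgeSet → setEdge G e False = G ∧ setEdge G e True = τ G := by
    intro G hG
    have := setEdge_mem G e
    simp only [hG] at this
    exact ⟨this, by simp [τ, hG]⟩
  have hκ : ∀ G, κ (τ G) = κ G := by
    intro G
    have h := binomialRandom_setEdge p G he
    by_cases hG : e ∈ G.edgeSet
    · have : e ∉ (τ G).edgeSet := by rw [hτmem]; simpa using hG
      rw [(htrue G hG).1, (htrue G hG).2] at h
      simp only [κ, hG, this, if_true, if_false, w, h]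
    · have : e ∈ (τ G).edgeSet := by rwa [hτmem]
      rw [(hfalse G hG).1, (hfalse G hG).2] at h
      simp only [κ, hG, this, if_true, if_false, w, h]
  have h1 : ∀ G, w G • edgeMean p e f G = w G • f G + (κ G • f (τ G) - κ G • f G) := by
    intro G
    by_cases hG : e ∈ G.edgeSet
    · simp only [edgeMean, (htrue G hG).1, (htrue G hG).2, κ, hG, if_true]
      module
    · simp only [edgeMean, (hfalse G hG).1, (hfalse G hG).2, κ, hG, if_false]
      module
  have h2 : ∑ G, κ G • f (τ G) = ∑ G, κ G • f G := by
    rw [← Equiv.sum_comp hτ.toPerm (fun G => κ G • f G)]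
    refine Finset.sum_congr rfl fun G _ => ?_
    simp [hκ]
  calc graphMean p (edgeMean p e f) = ∑ G, w G • edgeMean p e f G := rfl
    _ = ∑ G, w G • f G := by
      rw [Finset.sum_congr rfl fun G _ => h1 G, Finset.sum_add_distrib, Finset.sum_sub_distrib, h2]
      simp
    _ = graphMean p f := rfl

omit [Fintype V] [DecidableEq V] in
-- A two-point law with weights `p` and `1 - p` has variance `p (1 - p)` times the squared distance
-- between its values.
theorem edgeMean_norm_sq (e : Sym2 V) (f : SimpleGraph V → ℂ) (G : SimpleGraph V) :
    edgeMean p e (fun G => ‖f G‖ ^ 2) G = ‖edgeMean p e f G‖ ^ 2 +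
      p * (1 - p) * ‖f (setEdge G e True) - f (setEdge G e False)‖ ^ 2 := by
  simp only [edgeMean, ← Complex.normSq_eq_norm_sq, Complex.normSq_apply]
  simp
  ring

omit [NormedAddCommGroup E] [NormedSpace ℝ E] in
-- The pairs in `s` can be changed from `G` to `H` one at a time. With `s` everything, a function
-- insensitive to each pair is constant.
theorem eq_of_forall_setEdge {s : Finset (Sym2 V)} {f : SimpleGraph V → E}
    (hs : ∀ e ∈ s, ∀ G, f (setEdge G e True) = f (setEdge G e False)) :
    ∀ G H : SimpleGraph V, (∀ e ∉ s, e ∈ G.edgeSet ↔ e ∈ H.edgeSet) → f G = f H := by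
  induction s using Finset.induction_on with
  | empty =>
    intro G H h
    congr 1
    rw [← SimpleGraph.edgeSet_inj]
    ext e
    exact h e (Finset.notMem_empty e)
  | insert e s _ ih =>
    intro G H h
    have h0 : ∀ (b c : Prop) (G), f (setEdge G e b) = f (setEdge G e c) := by
      intro b c G
      have := hs e (Finset.mem_insert_self e s) G
      by_cases hb : b <;> by_cases hc : c <;> simp [hb, hc, this]
    rw [← setEdge_mem G e, h0 _ (e ∈ H.edgeSet)]
    refine ih (fun e' he' => hs e' (Finset.mem_insert_of_mem he')) _ _ fun e' he' => ?_
    by_cases hee : e' = e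
    · subst hee
      by_cases hd : e'.IsDiag
      · have h1 := SimpleGraph.not_isDiag_of_mem_edgeSet (G := H) (e := e')
        have h2 := SimpleGraph.not_isDiag_of_mem_edgeSet
          (G := setEdge G e' (e' ∈ H.edgeSet)) (e := e')
        tauto
      · exact mem_edgeSet_setEdge G hd _
    · rw [← h e' (by simp [hee, he'])]
      induction e' with | _ u v
      have := G.ne_of_adj (a := u) (b := v)
      simp only [SimpleGraph.mem_edgeSet, setEdge_adj]
      tauto

/-- The Efron–Stein inequality in terms of bounded differences. -/
theorem graphMean_norm_sq_le (s : Finset (Sym2 V)) {c : Sym2 V → ℝ} : ∀ {f : SimpleGraph V → ℂ},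
    (∀ e G, ‖f (setEdge G e True) - f (setEdge G e False)‖ ≤ c e) →
    (∀ e ∉ s, ∀ G, f (setEdge G e True) = f (setEdge G e False)) →
    graphMean p (fun G => ‖f G‖ ^ 2) ≤ ‖graphMean p f‖ ^ 2 + ∑ e ∈ s, c e ^ 2 := by
  induction s using Finset.induction_on with
  | empty =>
    intro f _ h
    have h0 : ∀ G, f G = f ⊥ := fun G =>
      eq_of_forall_setEdge (s := Finset.univ) (fun e _ => h e (Finset.notMem_empty e)) G ⊥ (by simp)
    have h1 : f = fun _ => f ⊥ := funext h0
    rw [h1, graphMean_const, graphMean_const]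
    simp
  | insert e s hes ih =>
    intro f hc h
    have hp0 := p.2.1
    have hp1 := p.2.2
    have hc0 : ∀ e, 0 ≤ c e := fun e => (norm_nonneg _).trans (hc e ⊥)
    have hself : ∀ (b : Prop) (G : SimpleGraph V),
        edgeMean p e f (setEdge G e b) = edgeMean p e f G := by
      intro b G
      simp only [edgeMean, setEdge_setEdge]
    have hdiff : ∀ e', e ≠ e' → ∀ G,
        edgeMean p e f (setEdge G e' True) - edgeMean p e f (setEdge G e' False) =
        (p : ℝ) • (f (setEdge (setEdge G e True) e' True) -
          f (setEdge (setEdge G e True) e' False)) +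
        (1 - (p : ℝ)) • (f (setEdge (setEdge G e False) e' True) -
          f (setEdge (setEdge G e False) e' False)) := by
      intro e' he' G
      simp only [edgeMean, setEdge_comm G he']
      module
    -- Averaging over `e` removes the dependence on `e` and, being a convex combination, does not
    -- increase the other influences. The price is one two-point variance, at most `c e ^ 2`.
    have hih := ih (f := edgeMean p e f) (by
      intro e' G
      obtain rfl | he' := eq_or_ne e e'
      · rw [hself, hself, sub_self, norm_zero]
        exact hc0 e
      · rw [hdiff e' he']
        refine (norm_add_le _ _).trans ?_
        rw [norm_smul, norm_smul, Real.norm_eq_abs, Real.norm_eq_abs, abs_of_nonneg hp0,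
          abs_of_nonneg (sub_nonneg.2 hp1)]
        calc _ ≤ (p : ℝ) * c e' + (1 - p) * c e' :=
              add_le_add (mul_le_mul_of_nonneg_left (hc _ _) hp0)
                (mul_le_mul_of_nonneg_left (hc _ _) (sub_nonneg.2 hp1))
          _ = c e' := by ring) (by
      intro e' he's G
      obtain rfl | he' := eq_or_ne e e'
      · rw [hself, hself]
      · rw [← sub_eq_zero, hdiff e' he', h e' (by simp [he's, he'.symm]),
          h e' (by simp [he's, he'.symm])]
        simp)
    rw [graphMean_edgeMean] at hih
    rw [← graphMean_edgeMean p e, Finset.sum_insert hes]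
    have h3 : graphMean p (edgeMean p e fun G => ‖f G‖ ^ 2) ≤
        graphMean p (fun G => ‖edgeMean p e f G‖ ^ 2 + c e ^ 2) := by
      refine graphMean_mono p fun G => ?_
      rw [edgeMean_norm_sq]
      have h4 : ‖f (setEdge G e True) - f (setEdge G e False)‖ ^ 2 ≤ c e ^ 2 :=
        pow_le_pow_left₀ (norm_nonneg _) (hc e G) 2
      have h5 : (p : ℝ) * (1 - p) ≤ 1 := by nlinarith
      have h6 : (p : ℝ) * (1 - p) * ‖f (setEdge G e True) - f (setEdge G e False)‖ ^ 2 ≤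
          1 * c e ^ 2 := mul_le_mul h5 h4 (sq_nonneg _) zero_le_one
      linarith
    rw [graphMean_add, graphMean_const] at h3
    linarith

theorem graphMean_norm_sub_sq_le {f : SimpleGraph V → ℂ} {c : Sym2 V → ℝ}
    (hc : ∀ e G, ‖f (setEdge G e True) - f (setEdge G e False)‖ ≤ c e) :
    graphMean p (fun G => ‖f G - graphMean p f‖ ^ 2) ≤ ∑ e, c e ^ 2 := by
  have := graphMean_norm_sq_le p Finset.univ (c := c) (f := fun G => f G - graphMean p f)
    (by simpa using hc) (by simp)
  rwa [graphMean_sub, graphMean_const, sub_self, norm_zero, sq 0, zero_mul, zero_add] at this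

theorem graphMean_ofReal (f : SimpleGraph V → ℝ) :
    graphMean p (fun G => (f G : ℂ)) = (graphMean p f : ℝ) := by
  simp [graphMean]

theorem graphMean_sub_sq_le {f : SimpleGraph V → ℝ} {c : Sym2 V → ℝ}
    (hc : ∀ e G, |f (setEdge G e True) - f (setEdge G e False)| ≤ c e) :
    graphMean p (fun G => (f G - graphMean p f) ^ 2) ≤ ∑ e, c e ^ 2 := by
  have := graphMean_norm_sub_sq_le p (f := fun G => (f G : ℂ)) (c := c) (by
    intro e G
    rw [← Complex.ofReal_sub, Complex.norm_real]
    exact hc e G)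
  simp only [graphMean_ofReal, ← Complex.ofReal_sub, Complex.norm_real, Real.norm_eq_abs,
    sq_abs] at this
  exact this

/-- Markov's inequality. -/
theorem measureReal_le_graphMean {f : SimpleGraph V → ℝ} (hf : ∀ G, 0 ≤ f G) {S : Set (SimpleGraph V)}
    {ε : ℝ} (h : ∀ G ∈ S, ε ≤ f G) :
    ε * (SimpleGraph.binomialRandom V p).real S ≤ graphMean p f := by
  classical
  have := SimpleGraph.measurableSingletonClass (V := V)
  have h1 : (SimpleGraph.binomialRandom V p).real S =
      ∑ G ∈ S.toFinset, (SimpleGraph.binomialRandom V p).real {G} := by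
    rw [MeasureTheory.sum_measureReal_singleton, Set.coe_toFinset]
  rw [h1, Finset.mul_sum]
  calc ∑ G ∈ S.toFinset, ε * (SimpleGraph.binomialRandom V p).real {G}
      ≤ ∑ G ∈ S.toFinset, (SimpleGraph.binomialRandom V p).real {G} • f G := by
        refine Finset.sum_le_sum fun G hG => ?_
        rw [mul_comm, smul_eq_mul]
        exact mul_le_mul_of_nonneg_left (h G (by simpa using hG)) MeasureTheory.measureReal_nonneg
    _ ≤ _ := Finset.sum_le_sum_of_subset_of_nonneg (Finset.subset_univ _) fun G _ _ =>
        smul_nonneg MeasureTheory.measureReal_nonneg (hf G)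

end RandomGraph

/-! ### The semicircle equation for the averaged resolvent trace. -/

section LocalLaw

variable {V : Type*}

/-- The indicator of adjacency of two vertices. -/
noncomputable def adjIndicator (G : SimpleGraph V) (u v : V) : ℝ :=
  open Classical in if G.Adj u v then 1 else 0

theorem adjIndicator_comm (G : SimpleGraph V) (u v : V) :
    adjIndicator G u v = adjIndicator G v u := by
  classical exact if_congr (G.adj_comm u v) rfl rfl

theorem adjIndicator_setEdge_true (G : SimpleGraph V) {u v : V} (h : u ≠ v) :
    adjIndicator (setEdge G s(u, v) True) u v = 1 := by
  simp [adjIndicator, setEdge_adj, h]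

theorem adjIndicator_setEdge_false (G : SimpleGraph V) (u v : V) :
    adjIndicator (setEdge G s(u, v) False) u v = 0 := by
  simp [adjIndicator, setEdge_adj]

theorem adjIndicator_setEdge_of_ne (G : SimpleGraph V) {u v : V} {e : Sym2 V} (h : s(u, v) ≠ e)
    (b : Prop) : adjIndicator (setEdge G e b) u v = adjIndicator G u v := by
  have := G.ne_of_adj (a := u) (b := v)
  have : (setEdge G e b).Adj u v ↔ G.Adj u v := by
    simp only [setEdge_adj]
    tauto
  classical exact if_congr this rfl rfl

variable [Fintype V] [DecidableEq V] (p : unitInterval) {δ : ℝ}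

/-- The adjacency matrix with centred off-diagonal entries, scaled by `δ`. -/
noncomputable def centeredAdjMatrix (δ : ℝ) (G : SimpleGraph V) : Matrix V V ℝ :=
  Matrix.of fun i j => if i = j then 0 else δ * (adjIndicator G i j - p)

omit [Fintype V] in
theorem centeredAdjMatrix_isHermitian (δ : ℝ) (G : SimpleGraph V) :
    (centeredAdjMatrix p δ G).IsHermitian := by
  ext i j
  simp only [centeredAdjMatrix, Matrix.conjTranspose_apply, Matrix.of_apply, star_trivial,
    adjIndicator_comm G j i, eq_comm (a := j)]

omit [Fintype V] in
theorem centeredAdjMatrix_setEdge_sub (δ : ℝ) (G : SimpleGraph V) {i j : V} (hij : i ≠ j) :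
    centeredAdjMatrix p δ (setEdge G s(i, j) True) -
      centeredAdjMatrix p δ (setEdge G s(i, j) False) = δ • symmSingle i j := by
  ext k l
  simp only [centeredAdjMatrix, Matrix.sub_apply, Matrix.of_apply, Matrix.smul_apply, symmSingle,
    Matrix.add_apply, Matrix.single_apply, smul_eq_mul]
  by_cases hkl : k = l
  · subst hkl
    have h1 : ¬ (i = k ∧ j = k) := fun h => hij (h.1.trans h.2.symm)
    have h2 : ¬ (j = k ∧ i = k) := fun h => hij (h.2.trans h.1.symm)
    simp [h1, h2]
  by_cases h : s(k, l) = s(i, j)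
  · rw [← h, adjIndicator_setEdge_true G hkl, adjIndicator_setEdge_false G]
    rcases Sym2.eq_iff.1 h with ⟨rfl, rfl⟩ | ⟨rfl, rfl⟩
    · simp [hkl, Ne.symm hkl]
      ring
    · simp [hkl, Ne.symm hkl]
      ring
  · rw [adjIndicator_setEdge_of_ne G h, adjIndicator_setEdge_of_ne G h, sub_self]
    have h1 : ¬ (i = k ∧ j = l) := by rintro ⟨rfl, rfl⟩; exact h rfl
    have h2 : ¬ (j = k ∧ i = l) := by rintro ⟨rfl, rfl⟩; exact h Sym2.eq_swap
    simp [h1, h2]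

/-- The resolvent of the scaled centred adjacency matrix. -/
noncomputable def adjResolvent (δ t : ℝ) (G : SimpleGraph V) : Matrix V V ℂ :=
  imResolvent (centeredAdjMatrix p δ G) t

theorem norm_adjResolvent_le (δ : ℝ) {t : ℝ} (ht : 0 < t) (G : SimpleGraph V) (i j : V) :
    ‖adjResolvent p δ t G i j‖ ≤ t⁻¹ :=
  norm_imResolvent_le (centeredAdjMatrix_isHermitian p δ G) ht i j

theorem norm_trace_adjResolvent_setEdge_sub_le (hδ : 0 ≤ δ) {t : ℝ} (ht : 0 < t) (e : Sym2 V)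
    (G : SimpleGraph V) :
    ‖(adjResolvent p δ t (setEdge G e True)).trace -
      (adjResolvent p δ t (setEdge G e False)).trace‖ ≤ 2 * δ * t⁻¹ ^ 2 := by
  by_cases he : e.IsDiag
  · rw [setEdge_of_isDiag G he, setEdge_of_isDiag G he, sub_self, norm_zero]
    positivity
  induction e with | _ i j
  exact norm_trace_imResolvent_sub_le (centeredAdjMatrix_isHermitian p δ _)
    (centeredAdjMatrix_isHermitian p δ _) ht hδ
    (centeredAdjMatrix_setEdge_sub p δ G (by simpa using he))

/-- The derivative of a resolvent entry with respect to the corresponding matrix entry, up to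
sign. -/
noncomputable def resolventQuad (R : Matrix V V ℂ) (i j : V) : ℂ := R j i * R j i + R j j * R i i

/-- A discrete integration by parts: the entry of `W` has mean zero, so only the response of `R j i`
to the edge survives, and the resolvent identity makes that response quadratic in `R`, to leading
order `-δ` times `resolventQuad`. The remainder is of third order in `δ`. -/
theorem norm_edgeMean_mul_resolvent_add_le (hδ : 0 ≤ δ) {t : ℝ} (ht : 0 < t) {i j : V}
    (hij : i ≠ j) (G : SimpleGraph V) :
    ‖edgeMean p s(i, j) (fun G => (centeredAdjMatrix p δ G i j : ℂ) * adjResolvent p δ t G j i) G +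
      ((p * (1 - p) * δ ^ 2 : ℝ) : ℂ) *
        edgeMean p s(i, j) (fun G => resolventQuad (adjResolvent p δ t G) i j) G‖ ≤
      p * (1 - p) * δ ^ 2 * (4 * δ * t⁻¹ ^ 3) := by
  have hp0 := p.2.1
  have hp1 : 0 ≤ 1 - (p : ℝ) := sub_nonneg.2 p.2.2
  set G₁ := setEdge G s(i, j) True with hG₁
  set G₀ := setEdge G s(i, j) False with hG₀
  have hsub : ∀ k l, adjResolvent p δ t G₁ k l - adjResolvent p δ t G₀ k l =
      - ((δ : ℂ) * (adjResolvent p δ t G₀ k i * adjResolvent p δ t G₁ j l +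
        adjResolvent p δ t G₀ k j * adjResolvent p δ t G₁ i l)) :=
    imResolvent_sub_apply (centeredAdjMatrix_isHermitian p δ _)
      (centeredAdjMatrix_isHermitian p δ _) ht (centeredAdjMatrix_setEdge_sub p δ G hij)
  have hdiff : ∀ k l, ‖adjResolvent p δ t G₁ k l - adjResolvent p δ t G₀ k l‖ ≤ 2 * δ * t⁻¹ ^ 2 :=
    norm_imResolvent_sub_le (centeredAdjMatrix_isHermitian p δ _)
      (centeredAdjMatrix_isHermitian p δ _) ht hδ (centeredAdjMatrix_setEdge_sub p δ G hij)
  have hb₁ := norm_adjResolvent_le p δ ht G₁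
  have hb₀ := norm_adjResolvent_le p δ ht G₀
  have hw₁ : centeredAdjMatrix p δ G₁ i j = δ * (1 - p) := by
    simp [centeredAdjMatrix, hij, hG₁, adjIndicator_setEdge_true G hij]
  have hw₀ : centeredAdjMatrix p δ G₀ i j = δ * (0 - p) := by
    simp [centeredAdjMatrix, hij, hG₀, adjIndicator_setEdge_false G]
  have ht' : 0 ≤ t⁻¹ := (inv_pos.2 ht).le
  simp only [edgeMean, ← hG₁, ← hG₀, hw₁, hw₀, resolventQuad]
  have hji := hsub j i
  have d1 := hdiff j i
  have d2 := hdiff j j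
  have d3 := hdiff i i
  have b1 := hb₁ j i
  have b2 := hb₁ i i
  have b3 := hb₀ j i
  have b4 := hb₀ j j
  generalize adjResolvent p δ t G₁ j i = a at *
  generalize adjResolvent p δ t G₁ j j = b at *
  generalize adjResolvent p δ t G₁ i i = c at *
  generalize adjResolvent p δ t G₀ j i = a' at *
  generalize adjResolvent p δ t G₀ j j = b' at *
  generalize adjResolvent p δ t G₀ i i = c' at *
  -- The left side begins as `p (1 - p) δ (a - a')`, and `hji` replaces `a - a'` by `-δ (a' a + b'
  -- c)`. Comparison with the averaged quadratic term leaves only products containing one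
  -- difference, each difference being at most `2 δ t⁻¹ ^ 2`.
  have key : (p : ℝ) • (((δ * (1 - p) : ℝ) : ℂ) * a) + (1 - (p : ℝ)) • (((δ * (0 - p) : ℝ) : ℂ) * a')
      + ((p * (1 - p) * δ ^ 2 : ℝ) : ℂ) *
      ((p : ℝ) • (a * a + b * c) + (1 - (p : ℝ)) • (a' * a' + b' * c')) =
      ((p * (1 - p) * δ ^ 2 : ℝ) : ℂ) * (((p : ℝ) : ℂ) * ((a - a') * a + (b - b') * c) +
        ((1 - p : ℝ) : ℂ) * (-(a' * (a - a') + b' * (c - c')))) := by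
    simp only [Complex.real_smul]
    push_cast
    linear_combination ((p : ℝ) : ℂ) * (1 - ((p : ℝ) : ℂ)) * (δ : ℂ) * hji
  rw [key, norm_mul, Complex.norm_real, Real.norm_eq_abs, abs_of_nonneg (by positivity)]
  refine mul_le_mul_of_nonneg_left ?_ (by positivity)
  refine (norm_add_le _ _).trans ?_
  rw [norm_mul, norm_mul, norm_neg, Complex.norm_real, Complex.norm_real, Real.norm_eq_abs,
    Real.norm_eq_abs, abs_of_nonneg hp0, abs_of_nonneg hp1]
  have e1 : ‖(a - a') * a + (b - b') * c‖ ≤ 4 * δ * t⁻¹ ^ 3 := by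
    refine (norm_add_le _ _).trans ?_
    rw [norm_mul, norm_mul]
    calc _ ≤ 2 * δ * t⁻¹ ^ 2 * t⁻¹ + 2 * δ * t⁻¹ ^ 2 * t⁻¹ := by gcongr
      _ = _ := by ring
  have e2 : ‖a' * (a - a') + b' * (c - c')‖ ≤ 4 * δ * t⁻¹ ^ 3 := by
    refine (norm_add_le _ _).trans ?_
    rw [norm_mul, norm_mul]
    calc _ ≤ t⁻¹ * (2 * δ * t⁻¹ ^ 2) + t⁻¹ * (2 * δ * t⁻¹ ^ 2) := by gcongr
      _ = _ := by ring
  calc _ ≤ (p : ℝ) * (4 * δ * t⁻¹ ^ 3) + (1 - p) * (4 * δ * t⁻¹ ^ 3) := by gcongr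
    _ = _ := by ring

theorem norm_graphMean_mul_resolvent_add_le (hδ : 0 ≤ δ) {t : ℝ} (ht : 0 < t) {i j : V}
    (hij : i ≠ j) :
    ‖graphMean p (fun G => (centeredAdjMatrix p δ G i j : ℂ) * adjResolvent p δ t G j i) +
      ((p * (1 - p) * δ ^ 2 : ℝ) : ℂ) *
        graphMean p (fun G => resolventQuad (adjResolvent p δ t G) i j)‖ ≤
      p * (1 - p) * δ ^ 2 * (4 * δ * t⁻¹ ^ 3) := by
  rw [← graphMean_edgeMean p s(i, j),
    ← graphMean_edgeMean p s(i, j) (fun G => resolventQuad (adjResolvent p δ t G) i j),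
    ← graphMean_mul_left, ← graphMean_add]
  refine (norm_graphMean_le p _).trans ?_
  rw [← graphMean_const (V := V) p (p * (1 - p) * δ ^ 2 * (4 * δ * t⁻¹ ^ 3) : ℝ)]
  exact graphMean_mono p fun G => norm_edgeMean_mul_resolvent_add_le p hδ ht hij G

theorem trace_centeredAdjMatrix_mul_resolvent (δ : ℝ) {t : ℝ} (ht : 0 < t) (G : SimpleGraph V) :
    ∑ i, ∑ j, (if i = j then 0 else
      (centeredAdjMatrix p δ G i j : ℂ) * adjResolvent p δ t G j i) =
      Fintype.card V + (t : ℂ) * Complex.I * (adjResolvent p δ t G).trace := by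
  have h := congrArg Matrix.trace
    (map_mul_imResolvent (centeredAdjMatrix_isHermitian p δ G) ht)
  rw [Matrix.trace_add, Matrix.trace_one, Matrix.trace_smul, smul_eq_mul] at h
  rw [adjResolvent, ← h]
  simp only [Matrix.trace, Matrix.diag, Matrix.mul_apply, Matrix.map_apply]
  refine Finset.sum_congr rfl fun i _ => Finset.sum_congr rfl fun j _ => ?_
  split_ifs with hij
  · subst hij
    simp [centeredAdjMatrix]
  · rfl

/-- Over all ordered pairs the terms `R i i * R j j` sum to the squared trace. The squares of
off-diagonal entries cost `t⁻¹ ^ 2` per row by Ward's identity, and the excluded diagonal costs at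
most `2 * t⁻¹ ^ 2` per row. -/
theorem norm_sum_resolventQuad_sub_le (δ : ℝ) {t : ℝ} (ht : 0 < t) (G : SimpleGraph V) :
    ‖∑ i, ∑ j, (if i = j then 0 else resolventQuad (adjResolvent p δ t G) i j) -
      (adjResolvent p δ t G).trace ^ 2‖ ≤ 3 * Fintype.card V * t⁻¹ ^ 2 := by
  set R := adjResolvent p δ t G with hR
  have h1 : ∑ i, ∑ j, (if i = j then 0 else resolventQuad R i j) - R.trace ^ 2 =
      ∑ i, (∑ j, R i j * R i j - 2 * (R i i * R i i)) := by
    have : ∀ i j, (if i = j then 0 else resolventQuad R i j) =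
        (R i j * R i j + R i i * R j j) - if i = j then 2 * (R i i * R i i) else 0 := by
      intro i j
      split_ifs with hij
      · subst hij; ring
      · rw [resolventQuad, hR, adjResolvent, imResolvent_comm (centeredAdjMatrix_isHermitian p δ G)]
        ring
    simp only [this, Finset.sum_sub_distrib, Finset.sum_add_distrib, Finset.sum_ite_eq,
      Finset.mem_univ, if_true]
    rw [Matrix.trace, sq, Finset.sum_mul_sum]
    simp only [Matrix.diag]
    ring
  rw [h1]
  refine (norm_sum_le _ _).trans ?_
  calc _ ≤ ∑ _i : V, 3 * t⁻¹ ^ 2 := by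
        refine Finset.sum_le_sum fun i _ => (norm_sub_le _ _).trans ?_
        have h2 : ‖∑ j, R i j * R i j‖ ≤ t⁻¹ ^ 2 := by
          refine (norm_sum_le _ _).trans ?_
          simp only [← sq, norm_pow]
          exact sum_norm_sq_imResolvent_le (centeredAdjMatrix_isHermitian p δ G) ht i
        have h3 : ‖2 * (R i i * R i i)‖ ≤ 2 * t⁻¹ ^ 2 := by
          rw [norm_mul, norm_mul, ← sq]
          simp only [Complex.norm_ofNat]
          have := norm_adjResolvent_le p δ ht G i i
          gcongr
        linarith
    _ = _ := by simp; ring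

/-- Sum the one-pair estimate over ordered pairs: `W R = 1 + i t R` evaluates the linear side, and
the quadratic side is nearly the squared trace. -/
theorem norm_graphMean_trace_le (hδ : 0 ≤ δ) {t : ℝ} (ht : 0 < t) :
    ‖(Fintype.card V : ℂ) + (t : ℂ) * Complex.I *
        graphMean p (fun G : SimpleGraph V => (adjResolvent p δ t G).trace) +
      ((p * (1 - p) * δ ^ 2 : ℝ) : ℂ) *
        graphMean p (fun G : SimpleGraph V => (adjResolvent p δ t G).trace ^ 2)‖ ≤
      p * (1 - p) * δ ^ 2 * (4 * δ * t⁻¹ ^ 3 * Fintype.card V ^ 2 +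
        3 * Fintype.card V * t⁻¹ ^ 2) := by
  have hp0 := p.2.1
  have hp1 : 0 ≤ 1 - (p : ℝ) := sub_nonneg.2 p.2.2
  have ht' : 0 ≤ t⁻¹ := (inv_pos.2 ht).le
  set κ : ℝ := p * (1 - p) * δ ^ 2 with hκ
  have hκ0 : 0 ≤ κ := by positivity
  have h1 : (Fintype.card V : ℂ) + (t : ℂ) * Complex.I *
      graphMean p (fun G : SimpleGraph V => (adjResolvent p δ t G).trace) =
      ∑ i, ∑ j, if i = j then 0 else graphMean p (fun G : SimpleGraph V =>
        (centeredAdjMatrix p δ G i j : ℂ) * adjResolvent p δ t G j i) := by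
    rw [← graphMean_mul_left, ← graphMean_const (V := V) p (Fintype.card V : ℂ), ← graphMean_add]
    simp only [← trace_centeredAdjMatrix_mul_resolvent p δ ht, graphMean_sum]
    refine Finset.sum_congr rfl fun i _ => Finset.sum_congr rfl fun j _ => ?_
    split_ifs
    · exact graphMean_const p 0
    · rfl
  have h2 : graphMean p (fun G : SimpleGraph V =>
        ∑ i, ∑ j, (if i = j then 0 else resolventQuad (adjResolvent p δ t G) i j)) =
      ∑ i, ∑ j, if i = j then 0 else graphMean p (fun G : SimpleGraph V =>
        resolventQuad (adjResolvent p δ t G) i j) := by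
    simp only [graphMean_sum]
    refine Finset.sum_congr rfl fun i _ => Finset.sum_congr rfl fun j _ => ?_
    split_ifs
    · exact graphMean_const p 0
    · rfl
  have h3 : ‖graphMean p (fun G : SimpleGraph V =>
        ∑ i, ∑ j, (if i = j then 0 else resolventQuad (adjResolvent p δ t G) i j)) -
        graphMean p (fun G : SimpleGraph V => (adjResolvent p δ t G).trace ^ 2)‖ ≤
      3 * Fintype.card V * t⁻¹ ^ 2 := by
    rw [← graphMean_sub]
    refine (norm_graphMean_le p _).trans ?_
    rw [← graphMean_const (V := V) p (3 * Fintype.card V * t⁻¹ ^ 2 : ℝ)]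
    exact graphMean_mono p fun G => norm_sum_resolventQuad_sub_le p δ ht G
  have h4 : ‖(∑ i, ∑ j, if i = j then 0 else graphMean p (fun G : SimpleGraph V =>
        (centeredAdjMatrix p δ G i j : ℂ) * adjResolvent p δ t G j i)) + (κ : ℂ) *
      ∑ i, ∑ j, (if i = j then 0 else graphMean p (fun G : SimpleGraph V =>
        resolventQuad (adjResolvent p δ t G) i j))‖ ≤
      κ * (4 * δ * t⁻¹ ^ 3 * Fintype.card V ^ 2) := by
    simp only [Finset.mul_sum, ← Finset.sum_add_distrib]
    refine (norm_sum_le _ _).trans ((Finset.sum_le_sum fun i _ => (norm_sum_le _ _).trans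
      (Finset.sum_le_sum fun j _ => ?_ )).trans (b := ∑ _i : V, ∑ _j : V,
        κ * (4 * δ * t⁻¹ ^ 3)) ?_)
    · split_ifs with hij
      · simp
        positivity
      · exact norm_graphMean_mul_resolvent_add_le p hδ ht hij
    · simp
      exact le_of_eq (by ring)
  rw [h1]
  rw [h2] at h3
  set T := graphMean p (fun G : SimpleGraph V => (adjResolvent p δ t G).trace ^ 2)
  set Q := ∑ i, ∑ j, if i = j then 0 else graphMean p (fun G : SimpleGraph V =>
    resolventQuad (adjResolvent p δ t G) i j)
  set P := ∑ i, ∑ j, if i = j then 0 else graphMean p (fun G : SimpleGraph V =>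
        (centeredAdjMatrix p δ G i j : ℂ) * adjResolvent p δ t G j i)
  calc ‖P + (κ : ℂ) * T‖ = ‖(P + (κ : ℂ) * Q) - (κ : ℂ) * (Q - T)‖ := by congr 1; ring
    _ ≤ ‖P + (κ : ℂ) * Q‖ + ‖(κ : ℂ) * (Q - T)‖ := norm_sub_le _ _
    _ ≤ κ * (4 * δ * t⁻¹ ^ 3 * Fintype.card V ^ 2) + κ * (3 * Fintype.card V * t⁻¹ ^ 2) := by
        rw [norm_mul (κ : ℂ), Complex.norm_real, Real.norm_eq_abs, abs_of_nonneg hκ0]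
        gcongr
    _ = _ := by ring

/-- The quadratic factors over its roots `i (a - t) / 2` and `-i (a + t) / 2`, where `a = √(t² + 4)
≥ 2`. A point with `Im m ≥ 0` is at distance at least `1` from the second root, so the residual
controls the distance to the first. -/
theorem norm_sub_semicircle_le {t : ℝ} (ht : 0 < t) {m : ℂ} (hm : 0 ≤ m.im) :
    ‖m - (((√(t ^ 2 + 4) - t) / 2 : ℝ) : ℂ) * Complex.I‖ ≤
      ‖1 + (t : ℂ) * Complex.I * m + m ^ 2‖ := by
  set a := √(t ^ 2 + 4) with ha
  have hs : a ^ 2 = t ^ 2 + 4 := Real.sq_sqrt (by positivity)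
  have ha2 : 2 ≤ a := Real.le_sqrt_of_sq_le (by nlinarith [sq_nonneg t])
  have h : 1 + (t : ℂ) * Complex.I * m + m ^ 2 = (m - (((a - t) / 2 : ℝ) : ℂ) * Complex.I) *
      (m + (((a + t) / 2 : ℝ) : ℂ) * Complex.I) := by
    have hs' : (a : ℂ) ^ 2 = (t : ℂ) ^ 2 + 4 := by exact_mod_cast hs
    push_cast
    linear_combination (-1 / 4 : ℂ) * hs' + (((a : ℂ) ^ 2 - (t : ℂ) ^ 2) / 4) * Complex.I_sq
  rw [h, norm_mul]
  refine le_mul_of_one_le_right (norm_nonneg _) ?_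
  have h1 := (le_abs_self _).trans
    (Complex.abs_im_le_norm (m + (((a + t) / 2 : ℝ) : ℂ) * Complex.I))
  simp only [Complex.add_im, Complex.mul_im, Complex.ofReal_re, Complex.ofReal_im, Complex.I_re,
    Complex.I_im] at h1
  linarith

omit [DecidableEq V] in
theorem card_sym2_le : (Fintype.card (Sym2 V) : ℝ) ≤ (Fintype.card V : ℝ) ^ 2 := by
  have h : Fintype.card (Sym2 V) ≤ Fintype.card (V × V) :=
    Fintype.card_le_of_surjective (fun x : V × V => s(x.1, x.2)) fun e => by
      induction e with | _ u v
      exact ⟨(u, v), rfl⟩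
  rw [Fintype.card_prod, ← sq] at h
  exact_mod_cast h

/-- The semicircle law for the Stieltjes transform on the imaginary axis, with an explicit error. -/
theorem graphMean_norm_stieltjes_sub_le [Nonempty V] (hδ : 0 ≤ δ)
    (hδp : p * (1 - p) * δ ^ 2 = (Fintype.card V : ℝ)⁻¹) {t : ℝ} (ht : 0 < t) :
    graphMean p (fun G : SimpleGraph V => ‖(Fintype.card V : ℂ)⁻¹ * (adjResolvent p δ t G).trace -
      (((√(t ^ 2 + 4) - t) / 2 : ℝ) : ℂ) * Complex.I‖) ≤
      4 * δ * t⁻¹ ^ 3 + 3 * t⁻¹ ^ 2 * (Fintype.card V : ℝ)⁻¹ + (2 * δ * t⁻¹ ^ 2) ^ 2 +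
        2 * δ * t⁻¹ ^ 2 := by
  have ht' : 0 ≤ t⁻¹ := (inv_pos.2 ht).le
  have hN : (0 : ℝ) < Fintype.card V := by exact_mod_cast Fintype.card_pos
  have hN' : (Fintype.card V : ℂ) ≠ 0 := by exact_mod_cast hN.ne'
  set N : ℝ := (Fintype.card V : ℝ) with hNdef
  set s : SimpleGraph V → ℂ := fun G => (Fintype.card V : ℂ)⁻¹ * (adjResolvent p δ t G).trace
    with hs
  set m := graphMean p s with hm
  set y : ℂ := (((√(t ^ 2 + 4) - t) / 2 : ℝ) : ℂ) * Complex.I with hy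
  have hvar : graphMean p (fun G => ‖s G - m‖ ^ 2) ≤ (2 * δ * t⁻¹ ^ 2) ^ 2 := by
    refine (graphMean_norm_sub_sq_le p (c := fun _ => N⁻¹ * (2 * δ * t⁻¹ ^ 2)) ?_).trans ?_
    · intro e G
      simp only [hs]
      rw [← mul_sub, norm_mul, norm_inv, Complex.norm_natCast]
      exact mul_le_mul_of_nonneg_left (norm_trace_adjResolvent_setEdge_sub_le p hδ ht e G)
        (inv_nonneg.2 hN.le)
    -- At most `N²` unordered pairs each contribute `(N⁻¹ * (2 δ t⁻¹ ^ 2)) ^ 2`, so the powers of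
    -- `N` cancel.
    · rw [Finset.sum_const, Finset.card_univ, nsmul_eq_mul]
      calc _ ≤ N ^ 2 * (N⁻¹ * (2 * δ * t⁻¹ ^ 2)) ^ 2 := by gcongr; exact card_sym2_le
        _ = _ := by field_simp
  have hmean : ‖1 + (t : ℂ) * Complex.I * m + graphMean p (fun G => s G ^ 2)‖ ≤
      4 * δ * t⁻¹ ^ 3 + 3 * t⁻¹ ^ 2 * N⁻¹ := by
    have h := norm_graphMean_trace_le (V := V) p hδ ht
    rw [hδp] at h
    have e1 : m = (Fintype.card V : ℂ)⁻¹ *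
        graphMean p (fun G : SimpleGraph V => (adjResolvent p δ t G).trace) := by
      rw [hm, hs, graphMean_mul_left]
    have e2 : graphMean p (fun G => s G ^ 2) = ((Fintype.card V : ℂ)⁻¹) ^ 2 *
        graphMean p (fun G : SimpleGraph V => (adjResolvent p δ t G).trace ^ 2) := by
      rw [← graphMean_mul_left]
      simp only [hs, mul_pow]
    have e3 : 1 + (t : ℂ) * Complex.I * m + graphMean p (fun G => s G ^ 2) =
        (Fintype.card V : ℂ)⁻¹ * ((Fintype.card V : ℂ) + (t : ℂ) * Complex.I *
        graphMean p (fun G : SimpleGraph V => (adjResolvent p δ t G).trace) + ((N⁻¹ : ℝ) : ℂ) *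
        graphMean p (fun G : SimpleGraph V => (adjResolvent p δ t G).trace ^ 2)) := by
      rw [e1, e2, hNdef]
      push_cast
      field_simp
    rw [e3, norm_mul, norm_inv, Complex.norm_natCast]
    calc _ ≤ N⁻¹ * _ := mul_le_mul_of_nonneg_left h (inv_nonneg.2 hN.le)
      _ = _ := by rw [← hNdef]; field_simp
  have hm0 : 0 ≤ m.im := by
    have : m.im = graphMean p fun G => (s G).im := by
      simp [hm, graphMean]
    rw [this]
    refine graphMean_nonneg p fun G => ?_
    simp only [hs]
    rw [← Complex.ofReal_natCast, ← Complex.ofReal_inv, Complex.im_ofReal_mul, adjResolvent,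
      im_trace_imResolvent (centeredAdjMatrix_isHermitian p δ G) ht]
    exact mul_nonneg (inv_nonneg.2 hN.le) (Finset.sum_nonneg fun i _ => by positivity)
  have hsq : graphMean p (fun G => s G ^ 2) - m ^ 2 = graphMean p (fun G => (s G - m) ^ 2) := by
    have : (fun G => (s G - m) ^ 2) = fun G => s G ^ 2 - 2 * m * s G + m ^ 2 := by
      ext G; ring
    rw [this, graphMean_add, graphMean_sub, graphMean_mul_left, graphMean_const]
    ring
  have hsq' : ‖graphMean p (fun G => s G ^ 2) - m ^ 2‖ ≤ (2 * δ * t⁻¹ ^ 2) ^ 2 := by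
    rw [hsq]
    refine (norm_graphMean_le p _).trans ?_
    simpa only [norm_pow] using hvar
  have hmy : ‖m - y‖ ≤ 4 * δ * t⁻¹ ^ 3 + 3 * t⁻¹ ^ 2 * N⁻¹ + (2 * δ * t⁻¹ ^ 2) ^ 2 := by
    refine (norm_sub_semicircle_le ht hm0).trans ?_
    calc ‖1 + (t : ℂ) * Complex.I * m + m ^ 2‖ = ‖(1 + (t : ℂ) * Complex.I * m +
          graphMean p (fun G => s G ^ 2)) - (graphMean p (fun G => s G ^ 2) - m ^ 2)‖ := by
          congr 1; ring
      _ ≤ _ := (norm_sub_le _ _).trans (add_le_add hmean hsq')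
  have hdev : graphMean p (fun G => ‖s G - m‖) ≤ 2 * δ * t⁻¹ ^ 2 := by
    have := (graphMean_sq_le p (fun G => ‖s G - m‖)).trans hvar
    exact (sq_le_sq₀ (graphMean_nonneg p fun _ => norm_nonneg _) (by positivity)).1 this
  calc graphMean p (fun G => ‖s G - y‖) ≤ graphMean p (fun G => ‖m - y‖ + ‖s G - m‖) :=
        graphMean_mono p fun G => by
          rw [add_comm, show s G - y = (s G - m) + (m - y) by ring]
          exact norm_add_le _ _
    _ ≤ _ := by
        rw [graphMean_add, graphMean_const]
        exact add_le_add hmy hdev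

end LocalLaw

/-! ### Mean convergence of the energy of the centred adjacency matrix. -/

section CenteredEnergy
open MeasureTheory Set

variable {V : Type*} [Fintype V] [DecidableEq V]

theorem matrixEnergy_eq_integral {W : Matrix V V ℝ} (hW : W.IsHermitian) :
    IntegrableOn (fun t : ℝ => ∑ i, hW.eigenvalues i ^ 2 / (hW.eigenvalues i ^ 2 + t ^ 2)) (Ioi 0) ∧
      ∫ t in Ioi (0 : ℝ), ∑ i, hW.eigenvalues i ^ 2 / (hW.eigenvalues i ^ 2 + t ^ 2) =
        Real.pi / 2 * matrixEnergy W hW := by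
  have h := fun i => integral_sq_div_sq_add_sq (hW.eigenvalues i)
  refine ⟨integrable_finsetSum _ fun i _ => (h i).1, ?_⟩
  rw [integral_finsetSum _ fun i _ => (h i).1, matrixEnergy, Finset.mul_sum]
  exact Finset.sum_congr rfl fun i _ => (h i).2

theorem sum_sq_div_eq_card_sub {W : Matrix V V ℝ} (hW : W.IsHermitian) {t : ℝ} (ht : 0 < t) :
    ∑ i, hW.eigenvalues i ^ 2 / (hW.eigenvalues i ^ 2 + t ^ 2) =
      Fintype.card V - t * (imResolvent W t).trace.im := by
  rw [im_trace_imResolvent hW ht, Finset.mul_sum, ← Finset.card_univ, Finset.card_eq_sum_ones]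
  push_cast
  rw [← Finset.sum_sub_distrib]
  refine Finset.sum_congr rfl fun i _ => ?_
  field_simp
  ring

variable (p : unitInterval)

omit [Fintype V] in
theorem abs_centeredAdjMatrix_le {δ : ℝ} (hδ : 0 ≤ δ) (G : SimpleGraph V) (i j : V) :
    |centeredAdjMatrix p δ G i j| ≤ δ := by
  have hp0 := p.2.1
  have hp1 := p.2.2
  simp only [centeredAdjMatrix, Matrix.of_apply, adjIndicator]
  split_ifs
  · simpa using hδ
  · rw [abs_mul, abs_of_nonneg hδ]
    refine mul_le_of_le_one_right hδ ?_
    rw [abs_le]; constructor <;> linarith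
  · rw [abs_mul, abs_of_nonneg hδ]
    refine mul_le_of_le_one_right hδ ?_
    rw [abs_le]; constructor <;> linarith

/-- The integrand in the integral formula for the energy per vertex. -/
noncomputable def energyDensity (δ t : ℝ) (G : SimpleGraph V) : ℝ :=
  (Fintype.card V : ℝ)⁻¹ * ∑ i, (centeredAdjMatrix_isHermitian p δ G).eigenvalues i ^ 2 /
    ((centeredAdjMatrix_isHermitian p δ G).eigenvalues i ^ 2 + t ^ 2)

theorem energyDensity_nonneg (δ t : ℝ) (G : SimpleGraph V) : 0 ≤ energyDensity p δ t G :=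
  mul_nonneg (by positivity) (Finset.sum_nonneg fun i _ => by positivity)

/-- An integrable envelope in `t`, uniform in the graph: `x² / (x² + t²) ≤ (1 + x²) / (1 + t²)`, and
the squared eigenvalues sum to the squared entries. In the scaling used, `Fintype.card V * δ ^ 2` is
constant. -/
theorem energyDensity_le [Nonempty V] {δ : ℝ} (hδ : 0 ≤ δ) {t : ℝ} (ht : 0 < t)
    (G : SimpleGraph V) :
    energyDensity p δ t G ≤ (1 + Fintype.card V * δ ^ 2) * (1 + t ^ 2)⁻¹ := by
  have hN : (0 : ℝ) < Fintype.card V := by exact_mod_cast Fintype.card_pos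
  have hW := centeredAdjMatrix_isHermitian p δ G
  have h1 : ∑ i, hW.eigenvalues i ^ 2 / (hW.eigenvalues i ^ 2 + t ^ 2) ≤
      ∑ i, (1 + hW.eigenvalues i ^ 2) * (1 + t ^ 2)⁻¹ := by
    refine Finset.sum_le_sum fun i _ => ?_
    rw [← div_eq_mul_inv, div_le_div_iff₀ (by positivity) (by positivity)]
    nlinarith [sq_nonneg (hW.eigenvalues i ^ 2), sq_nonneg t]
  have h2 : ∑ i, hW.eigenvalues i ^ 2 ≤ Fintype.card V ^ 2 * δ ^ 2 := by
    rw [sum_sq_eigenvalues hW]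
    calc _ ≤ ∑ _i : V, ∑ _j : V, δ ^ 2 := by
          refine Finset.sum_le_sum fun i _ => Finset.sum_le_sum fun j _ => ?_
          exact sq_le_sq.2 ((abs_centeredAdjMatrix_le p hδ G i j).trans (le_abs_self _))
      _ = _ := by simp; ring
  rw [← Finset.sum_mul, Finset.sum_add_distrib] at h1
  simp only [Finset.sum_const, Finset.card_univ, nsmul_eq_mul, mul_one] at h1
  rw [energyDensity]
  calc _ ≤ (Fintype.card V : ℝ)⁻¹ * ((Fintype.card V + Fintype.card V ^ 2 * δ ^ 2)
        * (1 + t ^ 2)⁻¹) := by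
        refine mul_le_mul_of_nonneg_left (h1.trans ?_) (by positivity)
        gcongr
    _ = _ := by field_simp

theorem graphMean_abs_energyDensity_sub_le [Nonempty V] {δ : ℝ} (hδ : 0 ≤ δ)
    (hδp : p * (1 - p) * δ ^ 2 = (Fintype.card V : ℝ)⁻¹) {t : ℝ} (ht : 0 < t) :
    graphMean p (fun G : SimpleGraph V => |energyDensity p δ t G -
      (1 - t * ((√(t ^ 2 + 4) - t) / 2))|) ≤
      t * (4 * δ * t⁻¹ ^ 3 + 3 * t⁻¹ ^ 2 * (Fintype.card V : ℝ)⁻¹ + (2 * δ * t⁻¹ ^ 2) ^ 2 +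
        2 * δ * t⁻¹ ^ 2) := by
  have hN : (0 : ℝ) < Fintype.card V := by exact_mod_cast Fintype.card_pos
  refine le_trans ?_ (mul_le_mul_of_nonneg_left
    (graphMean_norm_stieltjes_sub_le p hδ hδp ht) ht.le)
  rw [← graphMean_mul_left]
  refine graphMean_mono p fun G => ?_
  rw [energyDensity, sum_sq_div_eq_card_sub (centeredAdjMatrix_isHermitian p δ G) ht]
  have h := Complex.abs_im_le_norm ((Fintype.card V : ℂ)⁻¹ * (adjResolvent p δ t G).trace -
      (((√(t ^ 2 + 4) - t) / 2 : ℝ) : ℂ) * Complex.I)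
  rw [Complex.sub_im, Complex.im_ofReal_mul, Complex.I_im, ← Complex.ofReal_natCast,
    ← Complex.ofReal_inv, Complex.im_ofReal_mul, mul_one] at h
  calc _ = t * |(Fintype.card V : ℝ)⁻¹ * (adjResolvent p δ t G).trace.im -
        (√(t ^ 2 + 4) - t) / 2| := by
        rw [← abs_of_pos ht, ← abs_mul, abs_of_pos ht, ← abs_neg, adjResolvent]
        congr 1
        field_simp
        ring
    _ ≤ _ := by
        simp only [Complex.ofReal_inv, Complex.ofReal_natCast] at h ⊢
        exact mul_le_mul_of_nonneg_left h ht.le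

theorem integrableOn_energyDensity (δ : ℝ) (G : SimpleGraph V) :
    IntegrableOn (fun t => energyDensity p δ t G) (Ioi 0) :=
  (matrixEnergy_eq_integral (centeredAdjMatrix_isHermitian p δ G)).1.const_mul _

theorem integrableOn_abs_energyDensity_sub (δ : ℝ) (G : SimpleGraph V) :
    IntegrableOn (fun t => |energyDensity p δ t G - (1 - t * ((√(t ^ 2 + 4) - t) / 2))|) (Ioi 0) :=
  ((integrableOn_energyDensity p δ G).sub integral_one_sub_semicircle.1).abs

theorem integrableOn_graphMean_abs_energyDensity_sub (δ : ℝ) :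
    IntegrableOn (fun t => graphMean p (fun G : SimpleGraph V => |energyDensity p δ t G -
      (1 - t * ((√(t ^ 2 + 4) - t) / 2))|)) (Ioi 0) :=
  integrable_finsetSum _ fun G _ =>
    (integrableOn_abs_energyDensity_sub p δ G).const_mul _

/-- The mean is a finite sum, so it commutes with the integral, and `(2/π) (4/3)` is the limiting
constant. The right side is a deterministic integral, to which dominated convergence applies
although the probability space varies with the number of vertices. -/
theorem graphMean_abs_energy_sub_le (δ : ℝ) :
    graphMean p (fun G : SimpleGraph V => |(Fintype.card V : ℝ)⁻¹ *
      matrixEnergy (centeredAdjMatrix p δ G) (centeredAdjMatrix_isHermitian p δ G) -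
        8 / (3 * Real.pi)|) ≤
      2 / Real.pi * ∫ t in Ioi (0 : ℝ), graphMean p (fun G : SimpleGraph V =>
        |energyDensity p δ t G - (1 - t * ((√(t ^ 2 + 4) - t) / 2))|) := by
  have h1 : (∫ t in Ioi (0 : ℝ), graphMean p (fun G : SimpleGraph V =>
        |energyDensity p δ t G - (1 - t * ((√(t ^ 2 + 4) - t) / 2))|)) =
      graphMean p fun G : SimpleGraph V => ∫ t in Ioi (0 : ℝ),
        |energyDensity p δ t G - (1 - t * ((√(t ^ 2 + 4) - t) / 2))| := by
    simp only [graphMean, smul_eq_mul]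
    rw [integral_finsetSum _ fun G _ => (integrableOn_abs_energyDensity_sub p δ G).const_mul _]
    exact Finset.sum_congr rfl fun G _ => integral_const_mul _ _
  rw [h1, ← graphMean_mul_left]
  refine graphMean_mono p fun G => ?_
  have h2 : ∫ t in Ioi (0 : ℝ), (energyDensity p δ t G - (1 - t * ((√(t ^ 2 + 4) - t) / 2))) =
      (Fintype.card V : ℝ)⁻¹ * (Real.pi / 2 *
      matrixEnergy (centeredAdjMatrix p δ G) (centeredAdjMatrix_isHermitian p δ G)) - 4 / 3 := by
    rw [integral_sub (integrableOn_energyDensity p δ G) integral_one_sub_semicircle.1,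
      integral_one_sub_semicircle.2]
    simp only [energyDensity]
    rw [integral_const_mul, (matrixEnergy_eq_integral (centeredAdjMatrix_isHermitian p δ G)).2]
  have hpi := Real.pi_pos
  calc _ = 2 / Real.pi * |∫ t in Ioi (0 : ℝ),
        (energyDensity p δ t G - (1 - t * ((√(t ^ 2 + 4) - t) / 2)))| := by
        rw [h2, ← abs_of_pos (show 0 < 2 / Real.pi by positivity), ← abs_mul]
        congr 1
        field_simp
        ring
    _ ≤ _ := mul_le_mul_of_nonneg_left abs_integral_le_integral_abs (by positivity)

theorem tendsto_graphMean_abs_energy_sub (hp0 : 0 < (p : ℝ)) (hp1 : (p : ℝ) < 1) {δ : ℕ → ℝ}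
    (hδ0 : ∀ n, 0 ≤ δ n) (hδ : ∀ n, 0 < n → p * (1 - p) * δ n ^ 2 = (n : ℝ)⁻¹) :
    Tendsto (fun n : ℕ => graphMean p (fun G : SimpleGraph (Fin n) => |(n : ℝ)⁻¹ *
      matrixEnergy (centeredAdjMatrix p (δ n) G) (centeredAdjMatrix_isHermitian p (δ n) G) -
        8 / (3 * Real.pi)|)) atTop (𝓝 0) := by
  have hp1' : 0 < 1 - (p : ℝ) := sub_pos.2 hp1
  set C : ℝ := ((p : ℝ) * (1 - p))⁻¹ with hC
  have hδC : ∀ n, 0 < n → δ n ^ 2 = C * (n : ℝ)⁻¹ := fun n hn => by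
    rw [← hδ n hn, hC]; field_simp
  have hδlim : Tendsto δ atTop (𝓝 0) := by
    have h1 : Tendsto (fun n : ℕ => √(C * (n : ℝ)⁻¹)) atTop (𝓝 (√(C * 0))) :=
      ((tendsto_inv_atTop_nhds_zero_nat (𝕜 := ℝ)).const_mul C).sqrt
    rw [mul_zero, Real.sqrt_zero] at h1
    refine h1.congr' ?_
    filter_upwards [eventually_gt_atTop 0] with n hn
    rw [← hδC n hn, Real.sqrt_sq (hδ0 n)]
  set g : ℕ → ℝ → ℝ := fun n t => graphMean p (fun G : SimpleGraph (Fin n) =>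
        |energyDensity p (δ n) t G - (1 - t * ((√(t ^ 2 + 4) - t) / 2))|) with hg
  have hlim : Tendsto (fun n => ∫ t in Ioi (0 : ℝ), g n t) atTop
      (𝓝 (∫ _t in Ioi (0 : ℝ), (0 : ℝ))) := by
    refine tendsto_integral_filter_of_dominated_convergence
      (fun t => (1 + C) * (1 + t ^ 2)⁻¹ + |1 - t * ((√(t ^ 2 + 4) - t) / 2)|) ?_ ?_ ?_ ?_
    · exact Eventually.of_forall fun n =>
        (integrableOn_graphMean_abs_energyDensity_sub p (δ n)).aestronglyMeasurable
    · filter_upwards [eventually_gt_atTop 0] with n hn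
      have : Nonempty (Fin n) := ⟨⟨0, hn⟩⟩
      filter_upwards [ae_restrict_mem measurableSet_Ioi] with t ht
      rw [Real.norm_eq_abs, abs_of_nonneg (graphMean_nonneg p fun G => abs_nonneg _)]
      rw [← graphMean_const (V := Fin n) p
        ((1 + C) * (1 + t ^ 2)⁻¹ + |1 - t * ((√(t ^ 2 + 4) - t) / 2)|)]
      refine graphMean_mono p fun G => ?_
      refine (abs_sub _ _).trans (add_le_add ?_ le_rfl)
      rw [abs_of_nonneg (energyDensity_nonneg p _ _ _)]
      refine (energyDensity_le p (hδ0 n) ht G).trans (le_of_eq ?_)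
      have hn' : (n : ℝ) ≠ 0 := by exact_mod_cast hn.ne'
      rw [Fintype.card_fin, hδC n hn]
      field_simp
    · exact (integrable_inv_one_add_sq.integrableOn.const_mul _).add
        integral_one_sub_semicircle.1.abs
    · filter_upwards [ae_restrict_mem measurableSet_Ioi] with t ht
      have hub : Tendsto (fun n : ℕ => t * (4 * δ n * t⁻¹ ^ 3 + 3 * t⁻¹ ^ 2 * (n : ℝ)⁻¹ +
          (2 * δ n * t⁻¹ ^ 2) ^ 2 + 2 * δ n * t⁻¹ ^ 2)) atTop
          (𝓝 (t * (4 * 0 * t⁻¹ ^ 3 + 3 * t⁻¹ ^ 2 * 0 + (2 * 0 * t⁻¹ ^ 2) ^ 2 +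
            2 * 0 * t⁻¹ ^ 2))) :=
        ((((hδlim.const_mul 4).mul_const _).add
          (tendsto_inv_atTop_nhds_zero_nat.const_mul _)).add
          (((hδlim.const_mul 2).mul_const _).pow 2) |>.add
          ((hδlim.const_mul 2).mul_const _)).const_mul t
      have h0 : t * (4 * 0 * t⁻¹ ^ 3 + 3 * t⁻¹ ^ 2 * 0 + (2 * 0 * t⁻¹ ^ 2) ^ 2 +
            2 * 0 * t⁻¹ ^ 2) = 0 := by ring
      rw [h0] at hub
      refine tendsto_of_tendsto_of_tendsto_of_le_of_le' tendsto_const_nhds hub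
        (Eventually.of_forall fun n => graphMean_nonneg p fun G => abs_nonneg _) ?_
      filter_upwards [eventually_gt_atTop 0] with n hn
      have : Nonempty (Fin n) := ⟨⟨0, hn⟩⟩
      have := graphMean_abs_energyDensity_sub_le (V := Fin n) p (hδ0 n)
        (by rw [Fintype.card_fin]; exact hδ n hn) ht
      rwa [Fintype.card_fin] at this
  rw [integral_zero] at hlim
  have hlim' := hlim.const_mul (2 / Real.pi)
  rw [mul_zero] at hlim'
  refine squeeze_zero (fun n => graphMean_nonneg p fun G => abs_nonneg _) (fun n => ?_) hlim'
  have := graphMean_abs_energy_sub_le (V := Fin n) p (δ n)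
  rwa [Fintype.card_fin] at this

end CenteredEnergy

/-! ### Second moments of degrees, common neighbours and Harary entries. -/

section DegreesAndDistances

variable {V : Type*} [Fintype V] [DecidableEq V] (p : unitInterval)

omit [Fintype V] [DecidableEq V] in
theorem adjIndicator_self (G : SimpleGraph V) (v : V) : adjIndicator G v v = 0 := by
  simp [adjIndicator]

omit [Fintype V] [DecidableEq V] in
theorem adjIndicator_nonneg (G : SimpleGraph V) (u v : V) : 0 ≤ adjIndicator G u v := by
  rw [adjIndicator]; split_ifs <;> norm_num

omit [Fintype V] [DecidableEq V] in
theorem adjIndicator_le_one (G : SimpleGraph V) (u v : V) : adjIndicator G u v ≤ 1 := by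
  rw [adjIndicator]; split_ifs <;> norm_num

omit [DecidableEq V] in
theorem degree_eq_sum_adjIndicator (G : SimpleGraph V) (v : V) [Fintype (G.neighborSet v)] :
    (G.degree v : ℝ) = ∑ w, adjIndicator G v w := by
  classical
  have h : ∑ w, adjIndicator G v w = ∑ w, if G.Adj v w then (1 : ℝ) else 0 :=
    Finset.sum_congr rfl fun w _ => by rw [adjIndicator]
  rw [h, Finset.sum_boole, ← SimpleGraph.card_neighborFinset_eq_degree]
  congr 2
  ext w
  simp

/-- The indicator of incidence of a vertex with an unordered pair. -/
def incidence (v : V) (e : Sym2 V) : ℝ := ∑ w, if s(v, w) = e then 1 else 0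

theorem incidence_nonneg (v : V) (e : Sym2 V) : 0 ≤ incidence v e :=
  Finset.sum_nonneg fun w _ => by split_ifs <;> norm_num

theorem incidence_le_one (v : V) (e : Sym2 V) : incidence v e ≤ 1 := by
  rw [incidence, Finset.sum_boole]
  have : (Finset.univ.filter fun w => s(v, w) = e).card ≤ 1 := by
    refine Finset.card_le_one.2 fun a ha b hb => ?_
    simp only [Finset.mem_filter, Finset.mem_univ, true_and] at ha hb
    exact Sym2.congr_right.1 (ha.trans hb.symm)
  exact_mod_cast this

theorem sum_incidence (v : V) : ∑ e, incidence v e = Fintype.card V := by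
  simp only [incidence]
  rw [Finset.sum_comm]
  simp

omit [Fintype V] in
theorem abs_adjIndicator_setEdge_sub_le (G : SimpleGraph V) (e : Sym2 V) (u v : V) :
    |adjIndicator (setEdge G e True) u v - adjIndicator (setEdge G e False) u v| ≤
      if s(u, v) = e then 1 else 0 := by
  split_ifs with h
  · rw [abs_le]
    constructor <;> linarith [adjIndicator_nonneg (setEdge G e True) u v,
      adjIndicator_le_one (setEdge G e True) u v, adjIndicator_nonneg (setEdge G e False) u v,
      adjIndicator_le_one (setEdge G e False) u v]
  · rw [adjIndicator_setEdge_of_ne G h, adjIndicator_setEdge_of_ne G h]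
    simp

theorem graphMean_adjIndicator {u v : V} (h : u ≠ v) :
    graphMean p (fun G : SimpleGraph V => adjIndicator G u v) = p := by
  rw [← graphMean_edgeMean p s(u, v)]
  have : edgeMean p s(u, v) (fun G : SimpleGraph V => adjIndicator G u v) = fun _ => (p : ℝ) := by
    ext G
    simp [edgeMean, adjIndicator_setEdge_true G h, adjIndicator_setEdge_false G]
  rw [this, graphMean_const]

theorem graphMean_adjIndicator_mul {u v w : V} (huv : u ≠ v) (hvw : v ≠ w) (huw : u ≠ w) :
    graphMean p (fun G : SimpleGraph V => adjIndicator G u w * adjIndicator G v w) = p ^ 2 := by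
  rw [← graphMean_edgeMean p s(u, w)]
  have hne : s(v, w) ≠ s(u, w) := fun h => by
    rcases Sym2.eq_iff.1 h with ⟨h, _⟩ | ⟨h, _⟩
    · exact huv h.symm
    · exact hvw h
  have : edgeMean p s(u, w) (fun G : SimpleGraph V => adjIndicator G u w * adjIndicator G v w) =
      fun G => (p : ℝ) * adjIndicator G v w := by
    ext G
    simp [edgeMean, adjIndicator_setEdge_true G huw, adjIndicator_setEdge_false G,
      adjIndicator_setEdge_of_ne G hne]
  rw [this, graphMean_mul_left, graphMean_adjIndicator p hvw, sq]

theorem graphMean_degree_sub_sq_le [Nonempty V] (v : V) :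
    graphMean p (fun G : SimpleGraph V =>
      ((∑ w, adjIndicator G v w) - Fintype.card V * p) ^ 2) ≤ 4 * Fintype.card V := by
  have hp0 := p.2.1
  have hp1 := p.2.2
  have hN : (1 : ℝ) ≤ Fintype.card V := by exact_mod_cast Fintype.card_pos (α := V)
  have hmean : graphMean p (fun G : SimpleGraph V => ∑ w, adjIndicator G v w) =
      Fintype.card V * p - p := by
    rw [graphMean_sum]
    have : ∀ w, graphMean p (fun G : SimpleGraph V => adjIndicator G v w) =
        (p : ℝ) - if v = w then (p : ℝ) else 0 := by
      intro w
      split_ifs with h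
      · subst h
        simp only [adjIndicator_self]
        rw [graphMean_const, sub_self]
      · rw [graphMean_adjIndicator p h, sub_zero]
    simp [this, Finset.sum_sub_distrib]
  have hvar := graphMean_sub_sq_le p (f := fun G : SimpleGraph V => ∑ w, adjIndicator G v w)
    (c := incidence v) (by
      intro e G
      rw [← Finset.sum_sub_distrib]
      exact (Finset.abs_sum_le_sum_abs _ _).trans
        (Finset.sum_le_sum fun w _ => abs_adjIndicator_setEdge_sub_le G e v w))
  rw [hmean] at hvar
  have hsum : ∑ e, incidence v e ^ 2 ≤ Fintype.card V := by
    rw [← sum_incidence v]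
    refine Finset.sum_le_sum fun e _ => ?_
    nlinarith [incidence_nonneg v e, incidence_le_one v e]
  -- The exact mean degree is `(N - 1) p`; recentring at `N p` doubles the square and adds at most
  -- `2`.
  calc _ ≤ graphMean p (fun G : SimpleGraph V =>
        2 * ((∑ w, adjIndicator G v w) - (Fintype.card V * p - p)) ^ 2 + 2) :=
        graphMean_mono p fun G => by
          have : (p : ℝ) ^ 2 ≤ 1 := by nlinarith
          nlinarith [sq_nonneg ((∑ w, adjIndicator G v w) - (Fintype.card V * p - p) + p)]
    _ ≤ _ := by
        rw [graphMean_add, graphMean_mul_left, graphMean_const]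
        linarith

/-- The indicator of the event that two vertices have no common neighbour. -/
noncomputable def noCommonNeighbor (G : SimpleGraph V) (u v : V) : ℝ :=
  open Classical in if ∃ w, G.Adj u w ∧ G.Adj v w then 0 else 1

/-- Chebyshev's inequality for the number `f` of common neighbours. Its mean is `p² (N - 2)`, at
least `p² N / 2` because `N ≥ 4`, its variance is at most `4 N`, and having none forces a deviation
of the size of the mean. -/
theorem graphMean_noCommonNeighbor_le (hp0 : 0 < (p : ℝ)) (hN : 4 ≤ Fintype.card V) {u v : V}
    (huv : u ≠ v) :
    graphMean p (fun G : SimpleGraph V => noCommonNeighbor G u v) ≤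
      16 / ((p : ℝ) ^ 4 * Fintype.card V) := by
  have hN4 : (4 : ℝ) ≤ Fintype.card V := by exact_mod_cast hN
  set f : SimpleGraph V → ℝ := fun G => ∑ w, adjIndicator G u w * adjIndicator G v w with hf
  have hmean : graphMean p f = p ^ 2 * (Fintype.card V - 2) := by
    rw [hf, graphMean_sum]
    have : ∀ w, graphMean p (fun G : SimpleGraph V => adjIndicator G u w * adjIndicator G v w) =
        (p : ℝ) ^ 2 - (if u = w then (p : ℝ) ^ 2 else 0) - (if v = w then (p : ℝ) ^ 2 else 0) := by
      intro w
      by_cases h : u = w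
      · subst h
        simp [adjIndicator_self, graphMean_const, huv.symm]
      · by_cases h' : v = w
        · subst h'
          simp [adjIndicator_self, graphMean_const, h]
        · simp [graphMean_adjIndicator_mul p huv h' h, h, h']
    simp [this, Finset.sum_sub_distrib]
    ring
  have hvar := graphMean_sub_sq_le p (f := f) (c := fun e => incidence u e + incidence v e) (by
      intro e G
      simp only [hf]
      rw [← Finset.sum_sub_distrib]
      refine (Finset.abs_sum_le_sum_abs _ _).trans ?_
      rw [incidence, incidence, ← Finset.sum_add_distrib]
      refine Finset.sum_le_sum fun w _ => ?_
      have h1 := abs_adjIndicator_setEdge_sub_le G e u w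
      have h2 := abs_adjIndicator_setEdge_sub_le G e v w
      have h3 := adjIndicator_nonneg (setEdge G e False) u w
      have h4 := adjIndicator_le_one (setEdge G e False) u w
      have h5 := adjIndicator_nonneg (setEdge G e True) v w
      have h6 := adjIndicator_le_one (setEdge G e True) v w
      generalize adjIndicator (setEdge G e True) u w = a at *
      generalize adjIndicator (setEdge G e False) u w = a' at *
      generalize adjIndicator (setEdge G e True) v w = b at *
      generalize adjIndicator (setEdge G e False) v w = b' at *
      calc |a * b - a' * b'| = |(a - a') * b + a' * (b - b')| := by congr 1; ring
        _ ≤ |a - a'| * b + a' * |b - b'| := by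
            refine (abs_add_le _ _).trans ?_
            rw [abs_mul, abs_mul, abs_of_nonneg h5, abs_of_nonneg h3]
        _ ≤ |a - a'| * 1 + 1 * |b - b'| := by gcongr
        _ ≤ _ := by linarith)
  have hsum : ∑ e, (incidence u e + incidence v e) ^ 2 ≤ 4 * Fintype.card V := by
    have : ∑ e, (incidence u e + incidence v e) ^ 2 ≤
        ∑ e, 2 * (incidence u e + incidence v e) := by
      refine Finset.sum_le_sum fun e _ => ?_
      nlinarith [incidence_nonneg u e, incidence_le_one u e, incidence_nonneg v e,
        incidence_le_one v e]
    rw [← Finset.mul_sum, Finset.sum_add_distrib, sum_incidence, sum_incidence] at this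
    linarith
  have hm2 : (p : ℝ) ^ 2 * (Fintype.card V / 2) ≤ graphMean p f := by
    rw [hmean]
    gcongr
    linarith
  have hm0 : 0 < (p : ℝ) ^ 2 * (Fintype.card V / 2) := by positivity
  have key : ∀ G : SimpleGraph V, ((p : ℝ) ^ 2 * (Fintype.card V / 2)) ^ 2 *
      noCommonNeighbor G u v ≤ (f G - graphMean p f) ^ 2 := by
    intro G
    rw [noCommonNeighbor]
    split_ifs with h
    · rw [mul_zero]; exact sq_nonneg _
    · have : f G = 0 := by
        refine Finset.sum_eq_zero fun w _ => ?_
        have : ¬ (G.Adj u w ∧ G.Adj v w) := fun hw => h ⟨w, hw⟩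
        by_cases h1 : G.Adj u w
        · have h2 : ¬ G.Adj v w := fun h2 => this ⟨h1, h2⟩
          simp [adjIndicator, h2]
        · simp [adjIndicator, h1]
      rw [this, mul_one, zero_sub, neg_sq]
      exact pow_le_pow_left₀ hm0.le hm2 2
  have hfin := (graphMean_mono p key).trans (hvar.trans hsum)
  rw [graphMean_mul_left] at hfin
  rw [le_div_iff₀ (by positivity)]
  refine le_of_mul_le_mul_right (a := (Fintype.card V : ℝ)) ?_ (by positivity)
  linarith

omit [DecidableEq V] in
/-- For distinct vertices the reciprocal distance is `1` or `1 / 2`, according to adjacency, as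
soon as there is a common neighbour. -/
theorem abs_inv_dist_sub_le (G : SimpleGraph V) {u v : V} (huv : u ≠ v) :
    |((G.dist u v : ℕ) : ℝ)⁻¹ - (1 + adjIndicator G u v) / 2| ≤ noCommonNeighbor G u v := by
  by_cases hadj : G.Adj u v
  · rw [SimpleGraph.dist_eq_one_iff_adj.2 hadj]
    simp only [adjIndicator, hadj, noCommonNeighbor]
    split_ifs <;> norm_num
  · simp only [adjIndicator, hadj, noCommonNeighbor, if_false]
    split_ifs with h
    · obtain ⟨w, h1, h2⟩ := h
      have hle : G.dist u v ≤ 2 :=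
        SimpleGraph.dist_le (SimpleGraph.Walk.cons h1 (SimpleGraph.Walk.cons h2.symm .nil))
      have hr : G.Reachable u v := h1.reachable.trans h2.symm.reachable
      have h0 : G.dist u v ≠ 0 := fun h => huv (hr.dist_eq_zero_iff.1 h)
      have hne : G.dist u v ≠ 1 := fun h => hadj (SimpleGraph.dist_eq_one_iff_adj.1 h)
      have : G.dist u v = 2 := by omega
      rw [this]
      norm_num
    -- Without a common neighbour the inverse distance still lies in `[0, 1]`, the value `0`
    -- covering disconnected pairs, and so differs from `1/2` by at most `1`.
    · have h0 : (0 : ℝ) ≤ ((G.dist u v : ℕ) : ℝ)⁻¹ := by positivity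
      have h1 : ((G.dist u v : ℕ) : ℝ)⁻¹ ≤ 1 := Nat.cast_inv_le_one _
      rw [abs_le]
      constructor <;> linarith

omit [DecidableEq V] in
theorem sum_adjIndicator_le (G : SimpleGraph V) (v : V) :
    ∑ w, adjIndicator G v w ≤ Fintype.card V := by
  calc _ ≤ ∑ _w : V, (1 : ℝ) := Finset.sum_le_sum fun w _ => adjIndicator_le_one G v w
    _ = _ := by simp

omit [DecidableEq V] in
theorem noCommonNeighbor_sq (G : SimpleGraph V) (u v : V) :
    noCommonNeighbor G u v ^ 2 = noCommonNeighbor G u v := by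
  rw [noCommonNeighbor]
  split_ifs <;> norm_num

omit [DecidableEq V] in
theorem weightedDistanceMatrix_apply_of_ne (f : ℕ → ℕ → ℕ → ℝ) (G : SimpleGraph V) {i j : V}
    (hij : i ≠ j) : ∃ a b : ℕ, (a : ℝ) = ∑ w, adjIndicator G i w ∧
      (b : ℝ) = ∑ w, adjIndicator G j w ∧
      weightedDistanceMatrix f G i j = f (G.dist i j) a b := by
  classical
  refine ⟨G.degree i, G.degree j, degree_eq_sum_adjIndicator G i, degree_eq_sum_adjIndicator G j,
    ?_⟩
  simp only [weightedDistanceMatrix, Matrix.of_apply, hij, if_false]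

/-- The entries of the additive Harary matrix in terms of adjacency alone. -/
theorem graphMean_additiveHarary_sub_sq_le (hp0 : 0 < (p : ℝ)) (hN : 4 ≤ Fintype.card V) (i j : V) :
    graphMean p (fun G : SimpleGraph V => (additiveHararyMatrix G i j -
      if i = j then 0 else p * (Fintype.card V : ℝ) ^ 1 * (1 + adjIndicator G i j)) ^ 2) ≤
      (32 + 128 / (p : ℝ) ^ 4) * (Fintype.card V : ℝ) ^ (2 * 1) * (Fintype.card V : ℝ)⁻¹ := by
  have hN0 : (0 : ℝ) < Fintype.card V := by exact_mod_cast (by omega : 0 < Fintype.card V)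
  have : Nonempty V := Fintype.card_pos_iff.1 (by omega)
  have hp1 := p.2.2
  by_cases hij : i = j
  · simp only [hij, if_true, sub_zero]
    have : ∀ G : SimpleGraph V, additiveHararyMatrix G j j = 0 := fun G => by
      simp [additiveHararyMatrix, weightedDistanceMatrix]
    simp only [this]
    rw [sq, mul_zero, graphMean_const]
    positivity
  simp only [hij, if_false]
  set n : ℝ := (Fintype.card V : ℝ) with hn
  have key : ∀ G : SimpleGraph V, (additiveHararyMatrix G i j -
      p * n ^ 1 * (1 + adjIndicator G i j)) ^ 2 ≤
      4 * ((∑ w, adjIndicator G i w) - n * p) ^ 2 + 4 * ((∑ w, adjIndicator G j w) - n * p) ^ 2 +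
        8 * n ^ 2 * noCommonNeighbor G i j := by
    intro G
    obtain ⟨a, b, ha, hb, h⟩ := weightedDistanceMatrix_apply_of_ne additiveHararyWeight G hij
    have hd := abs_inv_dist_sub_le G hij
    have h0 : (0 : ℝ) ≤ ((G.dist i j : ℕ) : ℝ)⁻¹ := by positivity
    have h1 : ((G.dist i j : ℕ) : ℝ)⁻¹ ≤ 1 := Nat.cast_inv_le_one _
    rw [additiveHararyMatrix, h, additiveHararyWeight, ← ha, ← hb, div_eq_mul_inv]
    have hd2 := sq_le_sq' (abs_le.1 hd).1 (abs_le.1 hd).2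
    rw [noCommonNeighbor_sq] at hd2
    generalize ((G.dist i j : ℕ) : ℝ)⁻¹ = x at *
    generalize noCommonNeighbor G i j = c at *
    generalize adjIndicator G i j = y at *
    have hx2 : x ^ 2 ≤ 1 := by nlinarith
    -- The error splits as a degree deviation times `x ≤ 1`, plus the limiting degree sum `2np`
    -- times the error in the inverse distance.
    have e1 : (((a : ℝ) - n * p + (b - n * p)) * x) ^ 2 ≤
        2 * (a - n * p) ^ 2 + 2 * (b - n * p) ^ 2 := by
      rw [mul_pow]
      calc _ ≤ ((a : ℝ) - n * p + (b - n * p)) ^ 2 * 1 := by gcongr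
        _ ≤ _ := by nlinarith [sq_nonneg ((a : ℝ) - n * p - (b - n * p))]
    have e2 : (2 * n * p * (x - (1 + y) / 2)) ^ 2 ≤ 4 * n ^ 2 * c := by
      rw [mul_pow]
      have : (2 * n * (p : ℝ)) ^ 2 ≤ 4 * n ^ 2 := by
        have hp2 : (p : ℝ) ^ 2 ≤ 1 := by nlinarith
        calc (2 * n * (p : ℝ)) ^ 2 = 4 * n ^ 2 * (p : ℝ) ^ 2 := by ring
          _ ≤ 4 * n ^ 2 * 1 := by gcongr
          _ = _ := mul_one _
      gcongr
    calc _ = (((a : ℝ) - n * p + (b - n * p)) * x + 2 * n * p * (x - (1 + y) / 2)) ^ 2 := by ring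
      _ ≤ 2 * (((a : ℝ) - n * p + (b - n * p)) * x) ^ 2 + 2 * (2 * n * p * (x - (1 + y) / 2)) ^ 2 := by
        exact add_sq_le.trans (le_of_eq (by ring))
      _ ≤ _ := by linarith
  refine (graphMean_mono p key).trans ?_
  rw [graphMean_add, graphMean_add, graphMean_mul_left, graphMean_mul_left, graphMean_mul_left]
  have d1 := graphMean_degree_sub_sq_le p i
  have d2 := graphMean_degree_sub_sq_le p j
  have d3 := graphMean_noCommonNeighbor_le p hp0 hN hij
  rw [← hn] at d1 d2 d3
  calc _ ≤ 4 * (4 * n) + 4 * (4 * n) + 8 * n ^ 2 * (16 / ((p : ℝ) ^ 4 * n)) := by gcongr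
    _ = _ := by field_simp; ring

/-- The entries of the multiplicative Harary matrix in terms of adjacency alone. -/
theorem graphMean_multiplicativeHarary_sub_sq_le (hp0 : 0 < (p : ℝ)) (hN : 4 ≤ Fintype.card V)
    (i j : V) :
    graphMean p (fun G : SimpleGraph V => (multiplicativeHararyMatrix G i j -
      if i = j then 0 else p ^ 2 / 2 * (Fintype.card V : ℝ) ^ 2 * (1 + adjIndicator G i j)) ^ 2) ≤
      (32 + 128 / (p : ℝ) ^ 4) * (Fintype.card V : ℝ) ^ (2 * 2) * (Fintype.card V : ℝ)⁻¹ := by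
  have hN0 : (0 : ℝ) < Fintype.card V := by exact_mod_cast (by omega : 0 < Fintype.card V)
  have : Nonempty V := Fintype.card_pos_iff.1 (by omega)
  have hp1 := p.2.2
  by_cases hij : i = j
  · simp only [hij, if_true, sub_zero]
    have : ∀ G : SimpleGraph V, multiplicativeHararyMatrix G j j = 0 := fun G => by
      simp [multiplicativeHararyMatrix, weightedDistanceMatrix]
    simp only [this]
    rw [sq, mul_zero, graphMean_const]
    positivity
  simp only [hij, if_false]
  set n : ℝ := (Fintype.card V : ℝ) with hn
  have key : ∀ G : SimpleGraph V, (multiplicativeHararyMatrix G i j -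
      p ^ 2 / 2 * n ^ 2 * (1 + adjIndicator G i j)) ^ 2 ≤
      4 * n ^ 2 * ((∑ w, adjIndicator G i w) - n * p) ^ 2 +
        4 * n ^ 2 * ((∑ w, adjIndicator G j w) - n * p) ^ 2 +
        2 * n ^ 4 * noCommonNeighbor G i j := by
    intro G
    obtain ⟨a, b, ha, hb, h⟩ := weightedDistanceMatrix_apply_of_ne multiplicativeHararyWeight G hij
    have hd := abs_inv_dist_sub_le G hij
    have hbn := sum_adjIndicator_le G j
    have hb0 : (0 : ℝ) ≤ b := b.cast_nonneg
    have h0 : (0 : ℝ) ≤ ((G.dist i j : ℕ) : ℝ)⁻¹ := by positivity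
    have h1 : ((G.dist i j : ℕ) : ℝ)⁻¹ ≤ 1 := Nat.cast_inv_le_one _
    rw [multiplicativeHararyMatrix, h, multiplicativeHararyWeight, ← ha, ← hb, div_eq_mul_inv]
    rw [← hb, ← hn] at hbn
    have hd2 := sq_le_sq' (abs_le.1 hd).1 (abs_le.1 hd).2
    rw [noCommonNeighbor_sq] at hd2
    generalize ((G.dist i j : ℕ) : ℝ)⁻¹ = x at *
    generalize noCommonNeighbor G i j = c at *
    generalize adjIndicator G i j = y at *
    have hx2 : x ^ 2 ≤ 1 := by nlinarith
    have hp2 : (p : ℝ) ^ 2 ≤ 1 := by nlinarith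
    -- The product of degrees is compared with `(np)²` one factor at a time, using `b ≤ n`; the
    -- inverse distance is replaced last.
    have e1 : (((a - n * p) * b + n * p * (b - n * p)) * x) ^ 2 ≤
        2 * n ^ 2 * (a - n * p) ^ 2 + 2 * n ^ 2 * (b - n * p) ^ 2 := by
      rw [mul_pow]
      calc _ ≤ ((a - n * p) * b + n * p * (b - n * p)) ^ 2 * 1 := by gcongr
        _ ≤ 2 * (((a - n * p) * b) ^ 2 + (n * p * (b - n * p)) ^ 2) := by
          rw [mul_one]; exact add_sq_le
        _ = 2 * ((a - n * p) ^ 2 * b ^ 2) + 2 * (n ^ 2 * (b - n * p) ^ 2) * (p : ℝ) ^ 2 := by ring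
        _ ≤ 2 * ((a - n * p) ^ 2 * n ^ 2) + 2 * (n ^ 2 * (b - n * p) ^ 2) * 1 := by gcongr
        _ = _ := by ring
    have e2 : (n ^ 2 * p ^ 2 * (x - (1 + y) / 2)) ^ 2 ≤ n ^ 4 * c := by
      rw [mul_pow]
      have : (n ^ 2 * (p : ℝ) ^ 2) ^ 2 ≤ n ^ 4 := by
        calc (n ^ 2 * (p : ℝ) ^ 2) ^ 2 ≤ (n ^ 2 * 1) ^ 2 := by gcongr
          _ = _ := by ring
      gcongr
    calc _ = (((a - n * p) * b + n * p * (b - n * p)) * x +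
          n ^ 2 * p ^ 2 * (x - (1 + y) / 2)) ^ 2 := by ring
      _ ≤ 2 * (((a - n * p) * b + n * p * (b - n * p)) * x) ^ 2 +
          2 * (n ^ 2 * p ^ 2 * (x - (1 + y) / 2)) ^ 2 := by
        exact add_sq_le.trans (le_of_eq (by ring))
      _ ≤ _ := by linarith
  refine (graphMean_mono p key).trans ?_
  rw [graphMean_add, graphMean_add, graphMean_mul_left, graphMean_mul_left, graphMean_mul_left]
  have d1 := graphMean_degree_sub_sq_le p i
  have d2 := graphMean_degree_sub_sq_le p j
  have d3 := graphMean_noCommonNeighbor_le p hp0 hN hij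
  rw [← hn] at d1 d2 d3
  calc _ ≤ 4 * n ^ 2 * (4 * n) + 4 * n ^ 2 * (4 * n) +
        2 * n ^ 4 * (16 / ((p : ℝ) ^ 4 * n)) := by gcongr
    _ = (32 + 32 / (p : ℝ) ^ 4) * n ^ (2 * 2) * n⁻¹ := by field_simp; ring
    _ ≤ _ := by gcongr; norm_num

end DegreesAndDistances

/-! ### From mean convergence to high probability, and assembly. -/

section Main

theorem asymptoticWHP_of_tendsto_graphMean (p : unitInterval)
    {X : ∀ n : ℕ, SimpleGraph (Fin n) → ℝ} {c a : ℝ}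
    (h : Tendsto (fun n : ℕ => graphMean p fun G : SimpleGraph (Fin n) =>
      |X n G / (n : ℝ) ^ a - c|) atTop (𝓝 0)) : AsymptoticWHP p X c a := by
  intro ε hε
  rw [WithHighProbability]
  set S : ∀ n : ℕ, Set (SimpleGraph (Fin n)) :=
    fun n => {G | |X n G - c * (n : ℝ) ^ a| ≤ ε * (n : ℝ) ^ a} with hS
  have hcompl : Tendsto (fun n : ℕ => (SimpleGraph.binomialRandom (Fin n) p).real (S n)ᶜ) atTop
      (𝓝 0) := by
    have h' := h.const_mul ε⁻¹
    rw [mul_zero] at h'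
    refine tendsto_of_tendsto_of_tendsto_of_le_of_le' tendsto_const_nhds h'
      (Eventually.of_forall fun n => MeasureTheory.measureReal_nonneg) ?_
    filter_upwards [eventually_gt_atTop 0] with n hn
    have hna : (0 : ℝ) < (n : ℝ) ^ a := Real.rpow_pos_of_pos (by exact_mod_cast hn) a
    rw [← div_eq_inv_mul, le_div_iff₀ hε, mul_comm]
    refine measureReal_le_graphMean p (fun G => abs_nonneg _) fun G hG => ?_
    simp only [hS, Set.mem_compl_iff, Set.mem_ofPred_eq, not_le] at hG
    have : X n G / (n : ℝ) ^ a - c = (X n G - c * (n : ℝ) ^ a) / (n : ℝ) ^ a := by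
      field_simp
    rw [this, abs_div, abs_of_pos hna, le_div_iff₀ hna]
    exact hG.le
  have hreal : Tendsto (fun n : ℕ => (SimpleGraph.binomialRandom (Fin n) p).real (S n)) atTop
      (𝓝 1) := by
    have h1 := hcompl.const_sub 1
    rw [sub_zero] at h1
    refine h1.congr fun n => ?_
    have := SimpleGraph.measurableSingletonClass (V := Fin n)
    rw [MeasureTheory.probReal_compl_eq_one_sub (Set.toFinite (S n)).measurableSet]
    ring
  have := (ENNReal.continuous_ofReal.tendsto 1).comp hreal
  rw [ENNReal.ofReal_one] at this
  refine this.congr fun n => ?_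
  simp only [Function.comp, MeasureTheory.measureReal_def]
  exact ENNReal.ofReal_toReal (MeasureTheory.measure_ne_top _ _)

/-- Common to both Harary matrices: only entrywise mean-square closeness to `a n^k (1 + A i j)`
matters, with error `O(n^(2k-1))`. The term `W` has energy of order `n`, which with its factor `n^k
√n` gives the exponent `k + 3/2`. -/
theorem asymptoticWHP_matrixEnergy (p : unitInterval) (hp0 : 0 < (p : ℝ)) (hp1 : (p : ℝ) < 1)
    {a C : ℝ} (ha : 0 ≤ a) (k : ℕ) (H : ∀ n : ℕ, SimpleGraph (Fin n) → Matrix (Fin n) (Fin n) ℝ)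
    (hH : ∀ n G, (H n G).IsHermitian)
    (hB : ∀ n, 4 ≤ n → ∀ i j, graphMean p (fun G : SimpleGraph (Fin n) => (H n G i j -
      if i = j then 0 else a * (n : ℝ) ^ k * (1 + adjIndicator G i j)) ^ 2) ≤
      C * (n : ℝ) ^ (2 * k) * (n : ℝ)⁻¹) :
    AsymptoticWHP p (fun n G => matrixEnergy (H n G) (hH n G))
      (a * √(p * (1 - p)) * (8 / (3 * Real.pi))) (k + 3 / 2) := by
  have hσ : 0 < √((p : ℝ) * (1 - p)) := Real.sqrt_pos.2 (mul_pos hp0 (sub_pos.2 hp1))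
  have hσ2 : √((p : ℝ) * (1 - p)) ^ 2 = p * (1 - p) :=
    Real.sq_sqrt (mul_pos hp0 (sub_pos.2 hp1)).le
  set σ := √((p : ℝ) * (1 - p)) with hσdef
  -- This scaling gives the off-diagonal entries of the centred matrix variance `1 / n`.
  set δ : ℕ → ℝ := fun n => (σ * √n)⁻¹ with hδdef
  have hδ0 : ∀ n, 0 ≤ δ n := fun n => by positivity
  have hδ : ∀ n, 0 < n → p * (1 - p) * δ n ^ 2 = (n : ℝ)⁻¹ := by
    intro n hn
    have hn' : (0 : ℝ) < n := by exact_mod_cast hn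
    simp only [hδdef]
    rw [inv_pow, mul_pow, Real.sq_sqrt hn'.le, ← hσ2]
    field_simp
  have hlaw := tendsto_graphMean_abs_energy_sub p hp0 hp1 hδ0 hδ
  apply asymptoticWHP_of_tendsto_graphMean
  have hinv : Tendsto (fun n : ℕ => (√(n : ℝ))⁻¹) atTop (𝓝 0) :=
    (Real.tendsto_sqrt_atTop.comp tendsto_natCast_atTop_atTop).inv_tendsto_atTop
  have hub := (hlaw.const_mul (a * σ)).add (hinv.const_mul (a * (1 + p) * 2 + √C))
  rw [mul_zero, mul_zero, add_zero] at hub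
  refine tendsto_of_tendsto_of_tendsto_of_le_of_le' tendsto_const_nhds hub
    (Eventually.of_forall fun n => graphMean_nonneg p fun G => abs_nonneg _) ?_
  filter_upwards [eventually_ge_atTop 4] with n hn4
  have hn : 0 < n := by omega
  have hn' : (0 : ℝ) < n := by exact_mod_cast hn
  have hsn : 0 < √(n : ℝ) := Real.sqrt_pos.2 hn'
  have hsn2 : √(n : ℝ) ^ 2 = n := Real.sq_sqrt hn'.le
  have hpow : (n : ℝ) ^ ((k : ℝ) + 3 / 2) = (n : ℝ) ^ k * n * √n := by
    rw [show (k : ℝ) + 3 / 2 = (k : ℝ) + 1 + 1 / 2 by ring, Real.rpow_add hn', Real.rpow_add hn',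
      Real.rpow_natCast, Real.rpow_one, Real.sqrt_eq_rpow]
  set B : SimpleGraph (Fin n) → Matrix (Fin n) (Fin n) ℝ := fun G => Matrix.of fun i j =>
    H n G i j - if i = j then 0 else a * (n : ℝ) ^ k * (1 + adjIndicator G i j) with hBdef
  have hBh : ∀ G, (B G).IsHermitian := by
    intro G
    ext i j
    have := (hH n G).apply i j
    simp only [hBdef, Matrix.conjTranspose_apply, Matrix.of_apply, star_trivial] at this ⊢
    rw [this, adjIndicator_comm G j i]
    simp only [eq_comm]
  set J : Matrix (Fin n) (Fin n) ℝ :=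
    (a * (n : ℝ) ^ k * (1 + p)) • ((Matrix.of fun _ _ : Fin n => (1 : ℝ)) - 1) with hJdef
  have hJh : J.IsHermitian := by
    ext i j
    simp [hJdef, Matrix.one_apply, eq_comm]
  have hJ : matrixEnergy J hJh ≤ a * (n : ℝ) ^ k * (1 + p) * (2 * n) := by
    have := matrixEnergy_allOnes_sub_one_le _ hJh
    rwa [Fintype.card_fin, abs_of_nonneg (by positivity)] at this
  set W := fun G : SimpleGraph (Fin n) => centeredAdjMatrix p (δ n) G with hWdef
  have hWh : ∀ G, (W G).IsHermitian := fun G => centeredAdjMatrix_isHermitian p (δ n) G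
  have hdecomp : ∀ G, H n G = (a * (n : ℝ) ^ k * σ * √n) • W G + (J + B G) := by
    intro G
    ext i j
    simp only [hWdef, hJdef, hBdef, hδdef, centeredAdjMatrix, Matrix.add_apply, Matrix.smul_apply,
      Matrix.of_apply, Matrix.sub_apply, Matrix.one_apply, smul_eq_mul]
    split_ifs
    · ring
    · field_simp
      ring
  have hsmul : ∀ G, ((a * (n : ℝ) ^ k * σ * √n) • W G).IsHermitian := fun G => by
    have := (hWh G).eq
    rw [Matrix.IsHermitian, Matrix.conjTranspose_smul, this, star_trivial]
  have hα : 0 ≤ a * (n : ℝ) ^ k * σ * √n := by positivity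
  have hpt : ∀ G, |matrixEnergy (H n G) (hH n G) / (n : ℝ) ^ ((k : ℝ) + 3 / 2) -
      a * σ * (8 / (3 * Real.pi))| ≤ a * σ * |(n : ℝ)⁻¹ * matrixEnergy (W G) (hWh G) -
      8 / (3 * Real.pi)| + (a * (1 + p) * 2 * (√(n : ℝ))⁻¹ +
        ((n : ℝ) ^ k * n * √n)⁻¹ * matrixEnergy (B G) (hBh G)) := by
    intro G
    have h1 := abs_matrixEnergy_sub_le (hH n G) (hsmul G) (hJh.add (hBh G)) (hdecomp G)
    rw [matrixEnergy_smul (hWh G), abs_of_nonneg hα] at h1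
    have h2 := h1.trans ((matrixEnergy_add_le hJh (hBh G) _).trans (add_le_add_left hJ _))
    rw [hpow]
    set e := matrixEnergy (H n G) (hH n G)
    set w := matrixEnergy (W G) (hWh G)
    set b := matrixEnergy (B G) (hBh G)
    have hD : 0 < (n : ℝ) ^ k * n * √n := by positivity
    calc _ = |((n : ℝ) ^ k * n * √n)⁻¹ * (e - a * (n : ℝ) ^ k * σ * √n * w) +
          a * σ * ((n : ℝ)⁻¹ * w - 8 / (3 * Real.pi))| := by
          congr 1
          field_simp
          ring
      _ ≤ ((n : ℝ) ^ k * n * √n)⁻¹ * (a * (n : ℝ) ^ k * (1 + p) * (2 * n) + b) +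
          a * σ * |(n : ℝ)⁻¹ * w - 8 / (3 * Real.pi)| := by
          refine (abs_add_le _ _).trans ?_
          rw [abs_mul, abs_mul (a * σ), abs_of_pos (inv_pos.2 hD),
            abs_of_nonneg (mul_nonneg ha hσ.le)]
          gcongr
      _ = _ := by
          field_simp
          ring
  have hBmean : graphMean p (fun G => matrixEnergy (B G) (hBh G)) ≤
      √C * ((n : ℝ) ^ k * n) := by
    -- The squared energy is at most `n` times the sum of `n²` squared entries, each of mean at most
    -- `C n^(2k-1)`: in total `C n^(2k+2)`, smaller by a factor `n` than the square of the main
    -- term.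
    have h1 : graphMean p (fun G => matrixEnergy (B G) (hBh G) ^ 2) ≤
        C * ((n : ℝ) ^ k * n) ^ 2 := by
      calc _ ≤ graphMean p (fun G => (n : ℝ) * ∑ i, ∑ j, B G i j ^ 2) :=
            graphMean_mono p fun G => by
              have := matrixEnergy_le_sqrt (hBh G)
              rw [Fintype.card_fin] at this
              exact (Real.le_sqrt (matrixEnergy_nonneg _) (by positivity)).1 this
        _ = n * ∑ i, ∑ j, graphMean p (fun G => B G i j ^ 2) := by
            rw [graphMean_mul_left]
            simp only [graphMean_sum]
        _ ≤ n * ∑ _i : Fin n, ∑ _j : Fin n, C * (n : ℝ) ^ (2 * k) * (n : ℝ)⁻¹ := by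
            refine mul_le_mul_of_nonneg_left (Finset.sum_le_sum fun i _ =>
              Finset.sum_le_sum fun j _ => ?_) hn'.le
            exact hB n hn4 i j
        _ = _ := by
            simp only [Finset.sum_const, Finset.card_univ, Fintype.card_fin, nsmul_eq_mul]
            field_simp
            ring
    have h2 := (graphMean_sq_le p _).trans h1
    have h3 := Real.le_sqrt_of_sq_le h2
    refine h3.trans (le_of_eq ?_)
    rw [Real.sqrt_mul' _ (sq_nonneg _), Real.sqrt_sq (by positivity)]
  refine (graphMean_mono p hpt).trans ?_
  rw [graphMean_add, graphMean_add, graphMean_const, graphMean_mul_left, graphMean_mul_left,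
    add_mul]
  refine add_le_add le_rfl (add_le_add le_rfl ?_)
  calc _ ≤ ((n : ℝ) ^ k * n * √n)⁻¹ * (√C * ((n : ℝ) ^ k * n)) :=
        mul_le_mul_of_nonneg_left hBmean (by positivity)
    _ = _ := by field_simp

end Main

theorem corollary3p8 (p : ℝ) (hp0 : 0 < p) (hp1 : p < 1) :
    AsymptoticWHP ⟨p, hp0.le, hp1.le⟩
      (fun _ G => matrixEnergy (additiveHararyMatrix G) (additiveHararyMatrix_isHermitian G))
      (8 / (3 * Real.pi) * p * √(p * (1 - p))) (5 / 2) ∧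
    AsymptoticWHP ⟨p, hp0.le, hp1.le⟩
      (fun _ G => matrixEnergy (multiplicativeHararyMatrix G) (multiplicativeHararyMatrix_isHermitian G))
      (4 / (3 * Real.pi) * p ^ 2 * √(p * (1 - p))) (7 / 2) := by
  set q : unitInterval := ⟨p, hp0.le, hp1.le⟩ with hq
  constructor
  · have h := asymptoticWHP_matrixEnergy q hp0 hp1 (a := p) (C := 32 + 128 / p ^ 4) hp0.le 1
      (fun _ G => additiveHararyMatrix G) (fun _ G => additiveHararyMatrix_isHermitian G)
      (fun n hn i j => by
        have := graphMean_additiveHarary_sub_sq_le (V := Fin n) q hp0 (by simpa using hn) i j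
        rwa [Fintype.card_fin] at this)
    convert h using 1
    · simp only [hq]; ring
    · norm_num
  -- Here `(np)² (1 + A i j) / 2` gives `a = p² / 2`; in the additive case the degree sum `2np`
  -- absorbs the factor `1/2`.
  · have h := asymptoticWHP_matrixEnergy q hp0 hp1 (a := p ^ 2 / 2) (C := 32 + 128 / p ^ 4)
      (by positivity) 2
      (fun _ G => multiplicativeHararyMatrix G) (fun _ G => multiplicativeHararyMatrix_isHermitian G)
      (fun n hn i j => by
        have := graphMean_multiplicativeHarary_sub_sq_le (V := Fin n) q hp0 (by simpa using hn) i j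
        rwa [Fintype.card_fin] at this)
    convert h using 1
    · simp only [hq]; ring
    · norm_num
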